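/- **Setting.** Let $k:\mathcal X\times\mathcal X\to\mathbb R$ be a symmetric positive semidefinite kernel, $R\in\mathcal X^M$ inducing inputs with $K_{RR}$ invertible, $\sigma_n>0$, and let $(X_k,y_k)_{k=1}^K$ be mini-batches with $X_k\in\mathcal X^B$, $y_k\in\mathbb R^B$; $X,y$ denote the stacked data. Here $[K_{AA'}]_{ij}=k(a_i,a'_j)$, $Q_{AA}=K_{AR}K_{RR}^{-1}K_{RA}$, $D_{AA}=K_{AA}-Q_{AA}$, $H_k=K_{X_kR}K_{RR}^{-1}$, and $N(x;m,S)$ is the Gaussian density. The model is $p(u)=N(u;0,K_{RR})$, $p(f_k\mid u)=N(H_ku,D_{X_kX_k})$ (possibly singular), $p(y_k\mid f_k)=N(y_k;f_k,\sigma_n^2I)$, with the pairs $(f_k,y_k)$ conditionally independent given $u$; $p(y)$, $p(y_k\mid y_{1:k-1})$ and $p(u\mid y_{1:k})$ are the evidence, its factors and the exact posteriors of this model. For probability densities $q',q$ on $\mathbb R^M$ put $$\mathcal L_k(q',q)=\iint p(f_k\mid u)\,q(u)\,\log\frac{p(y_k\mid f_k)\,q'(u)}{q(u)}\,df_k\,du\in[-\infty,\infty),$$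 and $\mathcal L(q_1,\dots,q_K)=\sum_{k=1}^K\mathcal L_k(q_{k-1},q_k)$ with $q_0(u)=p(u)$. Define $\mu_0=0$, $\Sigma_0=K_{RR}$ and, for $k=1,\dots,K$, $$\Sigma_k=\bigl(\Sigma_{k-1}^{-1}+\sigma_n^{-2}H_k^TH_k\bigr)^{-1},\qquad \mu_k=\Sigma_k\bigl(\sigma_n^{-2}H_k^Ty_k+\Sigma_{k-1}^{-1}\mu_{k-1}\bigr),\qquad q_k^*(u)=N(u;\mu_k,\Sigma_k).$$ Put $r_k=y_k-H_k\mu_{k-1}$, $S_k=H_k\Sigma_{k-1}H_k^T+\sigma_n^2I$, $G_k=\Sigma_{k-1}H_k^TS_k^{-1}$, and $$\mathcal L_{REC}=\sum_{k=1}^K\Bigl[\log N(y_k;H_k\mu_{k-1},H_k\Sigma_{k-1}H_k^T+\sigma_n^2I)-\frac{\operatorname{tr}(D_{X_kX_k})}{2\sigma_n^2}\Bigr],$$ $$\mathcal L_{VFE}=\log N(y;0,Q_{XX}+\sigma_n^2I)-\frac{\operatorname{tr}(D_{XX})}{2\sigma_n^2},$$ $$\mathcal L_{SVGP}(\nu,S)=-\mathrm{KL}\bigl(q\,\|\,p(u)\bigr)+\sum_{k=1}^K\iint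 q(u)\,p(f_k\mid u)\log p(y_k\mid f_k)\,df_k\,du,\qquad q=N(\nu,S).$$ **Theorem.** 1. $\log p(y)=\sum_k\log p(y_k\mid y_{1:k-1})$, where $p(y_k\mid y_{1:k-1})=\int p(y_k\mid u)\,p(u\mid y_{1:k-1})\,du$, and for all densities $q_1,\dots,q_K$, $\ \log p(y)\ge\sum_k\mathcal L_k\bigl(p(\cdot\mid y_{1:k-1}),q_k\bigr)$. 2. Recursive maximization (given $q_{k-1}$, let $q_k$ maximize $\mathcal L_k(q_{k-1},\cdot)$ over all probability densities, starting from $q_0=p(u)$) has the solution $q_k=q_k^*$, unique up to Lebesgue-null sets, and $\mathcal L(q_1^*,\dots,q_K^*)=\mathcal L_{REC}$. 3. All $\Sigma_k$ are positive definite, and the updates are the recursive Bayesian ones, $N(y_k;H_ku,\sigma_n^2I)\,q_{k-1}^*(u)=N(y_k;H_k\mu_{k-1},S_k)\,q_k^*(u)$ for all $u$, and have the Kalman form $\mu_k=\mu_{k-1}+G_kr_k$, $\Sigma_k=\Sigma_{k-1}-G_kS_kG_k^T$. 4. $\mathcal L_{REC}=\sum_k\bigl[\log N(r_k;0,S_k)-\operatorname{tr}(D_{X_kX_k})/(2\sigma_n^2)\bigr]$,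 $\ \mathcal L_{REC}=\mathcal L_{VFE}$, and $\mathcal L_{REC}\le\log p(y)$. 5. $\mathcal L_{SVGP}(\nu,S)\le\mathcal L_{REC}$ for all $\nu\in\mathbb R^M$ and all positive definite $S$, with equality at $(\nu,S)=(\mu_K,\Sigma_K)$. -/

import Mathlib

open MeasureTheory ProbabilityTheory
open scoped ENNReal Matrix MatrixOrder

noncomputable section

namespace SparseGP

/-- The Gaussian density `N(x; m, S)` with mean `m` and (positive definite) covariance `S`. -/
def gaussianPdf {ι : Type*} [Fintype ι] [DecidableEq ι] (m : ι → ℝ) (S : Matrix ι ι ℝ)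
    (x : ι → ℝ) : ℝ :=
  (√((2 * Real.pi) ^ Fintype.card ι * S.det))⁻¹ *
    Real.exp (-(1 / 2) * ((x - m) ⬝ᵥ (S⁻¹ *ᵥ (x - m))))

/-- The integral of an extended-real function, as the integral of the positive part minus the
integral of the negative part. (In every use below the positive part has finite integral, so the
integral is a well-defined element of `[-∞, ∞)`.) -/
def extIntegral {α : Type*} [MeasurableSpace α] (P : Measure α) (g : α → EReal) : EReal :=
  ((∫⁻ x, (g x).toENNReal ∂P : ℝ≥0∞) : EReal) - ((∫⁻ x, (-(g x)).toENNReal ∂P : ℝ≥0∞) : EReal)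

/-- Probability densities with respect to Lebesgue measure on `ℝᴹ`. -/
def IsDensity {M : ℕ} (q : (Fin M → ℝ) → ℝ≥0∞) : Prop :=
  Measurable q ∧ ∫⁻ u, q u = 1

/-- The data and parameters of a sparse Gaussian process regression problem: a covariance kernel,
`M` inducing inputs `R`, the noise standard deviation `σ`, and `K` mini-batches of `B` inputs `X k`
with observations `y k`. -/
structure Model (𝒳 : Type*) (M K B : ℕ) where
  kernel : 𝒳 → 𝒳 → ℝ
  R : Fin M → 𝒳
  σ : ℝ
  X : Fin K → Fin B → 𝒳
  y : Fin K → Fin B → ℝ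

namespace Model

variable {𝒳 : Type*} {M K B : ℕ} (m : Model 𝒳 M K B)

/-- The matrix `K_{A A'}` of kernel values. -/
def gram {ι κ : Type*} (A : ι → 𝒳) (A' : κ → 𝒳) : Matrix ι κ ℝ :=
  Matrix.of fun i j => m.kernel (A i) (A' j)

/-- `K_{RR}`, the prior covariance of the inducing outputs. -/
def KRR : Matrix (Fin M) (Fin M) ℝ := m.gram m.R m.R

/-- `Q_{AA} = K_{AR} K_{RR}⁻¹ K_{RA}`. -/
def Q {ι : Type*} (A : ι → 𝒳) : Matrix ι ι ℝ := m.gram A m.R * m.KRR⁻¹ * m.gram m.R A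

/-- `D_{AA} = K_{AA} - Q_{AA}`. -/
def D {ι : Type*} (A : ι → 𝒳) : Matrix ι ι ℝ := m.gram A A - m.Q A

/-- `H_k = K_{X_k R} K_{RR}⁻¹`. -/
def H (k : Fin K) : Matrix (Fin B) (Fin M) ℝ := m.gram (m.X k) m.R * m.KRR⁻¹

/-- The noise covariance `σ² I`. -/
def noise (ι : Type*) [DecidableEq ι] : Matrix ι ι ℝ := m.σ ^ 2 • (1 : Matrix ι ι ℝ)

/-- The prior density `p(u) = N(u; 0, K_{RR})`. -/
def prior (u : Fin M → ℝ) : ℝ≥0∞ := ENNReal.ofReal (gaussianPdf 0 m.KRR u)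

/-- The conditional law `p(f_k | u) = N(H_k u, D_{X_k X_k})`; its covariance may be singular. -/
def latent (k : Fin K) : Kernel (Fin M → ℝ) (EuclideanSpace ℝ (Fin B)) where
  toFun u := multivariateGaussian (WithLp.toLp 2 (m.H k *ᵥ u)) (m.D (m.X k))
  measurable' := by
    refine Measure.measurable_of_measurable_coe _ fun s hs => ?_
    have hmap : ∀ u : Fin M → ℝ,
        multivariateGaussian (WithLp.toLp 2 (m.H k *ᵥ u)) (m.D (m.X k)) s =
          stdGaussian (EuclideanSpace ℝ (Fin B)) (Prod.mk u ⁻¹'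
            ((fun p : (Fin M → ℝ) × EuclideanSpace ℝ (Fin B) =>
              WithLp.toLp 2 (m.H k *ᵥ p.1) +
                Matrix.toEuclideanCLM (𝕜 := ℝ) (CFC.sqrt (m.D (m.X k))) p.2) ⁻¹' s)) := by
      intro u
      rw [multivariateGaussian, Measure.map_apply (by fun_prop) hs]
      rfl
    simp_rw [hmap]
    refine measurable_measure_prodMk_left (measurableSet_preimage ?_ hs)
    refine Measurable.add ?_ ?_
    · exact (WithLp.measurable_toLp 2 _).comp
        ((Continuous.measurable (by fun_prop : Continuous fun v => m.H k *ᵥ v)).comp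
          measurable_fst)
    · fun_prop

instance (k : Fin K) : IsMarkovKernel (m.latent k) :=
  ⟨fun u => inferInstanceAs (IsProbabilityMeasure
    (multivariateGaussian (WithLp.toLp 2 (m.H k *ᵥ u)) (m.D (m.X k))))⟩

/-- The likelihood `p(y_k | f_k) = N(y_k; f_k, σ² I)`. -/
def lik (k : Fin K) (f : EuclideanSpace ℝ (Fin B)) : ℝ :=
  gaussianPdf f.ofLp (m.noise (Fin B)) (m.y k)

/-- The joint variational law `p(f_k | u) q(u)` of `(u, f_k)`. -/
def joint (k : Fin K) (q : (Fin M → ℝ) → ℝ≥0∞) :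
    Measure ((Fin M → ℝ) × EuclideanSpace ℝ (Fin B)) :=
  (volume.withDensity q) ⊗ₘ (m.latent k)

/-! ### The exact sparse model -/

/-- `p(y_k | u) = ∫ p(y_k | f_k) p(f_k | u) df_k`. -/
def condLik (k : Fin K) (u : Fin M → ℝ) : ℝ≥0∞ :=
  ∫⁻ f, ENNReal.ofReal (m.lik k f) ∂(m.latent k u)

/-- `p(y_{1:k} | u) p(u)`, the mini-batches being conditionally independent given `u`. -/
def unnormPosterior (k : Fin (K + 1)) (u : Fin M → ℝ) : ℝ≥0∞ :=
  (∏ j : Fin K, if j.castSucc < k then m.condLik j u else 1) * m.prior u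

/-- `p(y_{1:k}) = ∫ p(y_{1:k} | u) p(u) du`. -/
def evidence (k : Fin (K + 1)) : ℝ≥0∞ := ∫⁻ u, m.unnormPosterior k u

/-- The exact posterior density `p(u | y_{1:k})`. -/
def exactPosterior (k : Fin (K + 1)) (u : Fin M → ℝ) : ℝ≥0∞ :=
  m.unnormPosterior k u / m.evidence k

/-! ### The recursive variational bound -/

/-- The `k`-th summand of the bound,
`∫∫ p(f_k | u) q(u) log (p(y_k | f_k) q'(u) / q(u)) df_k du`, where `q'` is the preceding
distribution. -/
def term (k : Fin K) (q' q : (Fin M → ℝ) → ℝ≥0∞) : EReal :=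
  extIntegral (m.joint k q) fun z =>
    ENNReal.log (ENNReal.ofReal (m.lik k z.2) * q' z.1 / q z.1)

/-- The bound `𝓛(q_1, …, q_K)`; `q k.succ` is the distribution after mini-batch `k`, and
`q k.castSucc` the one before it. -/
def bound (q : Fin (K + 1) → (Fin M → ℝ) → ℝ≥0∞) : EReal :=
  ∑ k : Fin K, m.term k (q k.castSucc) (q k.succ)

/-- `q_0 = p(u)`, and each `q_k` is a density that maximizes, given the preceding distribution, the
`k`-th summand of the bound among all densities. -/
def IsRecursiveMaximizer (q : Fin (K + 1) → (Fin M → ℝ) → ℝ≥0∞) : Prop :=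
  q 0 = m.prior ∧ ∀ k : Fin K, IsDensity (q k.succ) ∧
    ∀ p, IsDensity p → m.term k (q k.castSucc) p ≤ m.term k (q k.castSucc) (q k.succ)

/-! ### The Gaussian recursion -/

/-- One update `(μ_{k-1}, Σ_{k-1}) ↦ (μ_k, Σ_k)`, where
`Σ_k = (Σ_{k-1}⁻¹ + σ⁻² H_kᵀ H_k)⁻¹` and `μ_k = Σ_k (σ⁻² H_kᵀ y_k + Σ_{k-1}⁻¹ μ_{k-1})`. -/
def update (k : Fin K) (p : (Fin M → ℝ) × Matrix (Fin M) (Fin M) ℝ) :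
    (Fin M → ℝ) × Matrix (Fin M) (Fin M) ℝ :=
  let S := (p.2⁻¹ + (m.σ ^ 2)⁻¹ • ((m.H k)ᵀ * m.H k))⁻¹
  (S *ᵥ ((m.σ ^ 2)⁻¹ • ((m.H k)ᵀ *ᵥ m.y k) + p.2⁻¹ *ᵥ p.1), S)

/-- The parameters `(μ_k, Σ_k)` for `k = 0, …, K`, with `μ_0 = 0` and `Σ_0 = K_{RR}`. -/
def params (k : Fin (K + 1)) : (Fin M → ℝ) × Matrix (Fin M) (Fin M) ℝ :=
  Fin.induction (motive := fun _ => (Fin M → ℝ) × Matrix (Fin M) (Fin M) ℝ)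
    (0, m.KRR) (fun k p => m.update k p) k

/-- `μ_k`. -/
def mean (k : Fin (K + 1)) : Fin M → ℝ := (m.params k).1

/-- `Σ_k`. -/
def cov (k : Fin (K + 1)) : Matrix (Fin M) (Fin M) ℝ := (m.params k).2

/-- The Gaussian densities `q_k^*(u) = N(u; μ_k, Σ_k)`. -/
def qStar (k : Fin (K + 1)) (u : Fin M → ℝ) : ℝ≥0∞ :=
  ENNReal.ofReal (gaussianPdf (m.mean k) (m.cov k) u)

/-- The residual `r_k = y_k - H_k μ_{k-1}`. -/
def resid (k : Fin K) : Fin B → ℝ := m.y k - m.H k *ᵥ m.mean k.castSucc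

/-- `S_k = H_k Σ_{k-1} H_kᵀ + σ² I`. -/
def innovCov (k : Fin K) : Matrix (Fin B) (Fin B) ℝ :=
  m.H k * m.cov k.castSucc * (m.H k)ᵀ + m.noise (Fin B)

/-- The gain `G_k = Σ_{k-1} H_kᵀ S_k⁻¹`. -/
def gain (k : Fin K) : Matrix (Fin M) (Fin B) ℝ :=
  m.cov k.castSucc * (m.H k)ᵀ * (m.innovCov k)⁻¹

/-! ### The bounds to be compared -/

/-- The recursive collapsed bound. -/
def LREC : ℝ :=
  ∑ k : Fin K, (Real.log (gaussianPdf (m.H k *ᵥ m.mean k.castSucc) (m.innovCov k) (m.y k)) -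
    (m.D (m.X k)).trace / (2 * m.σ ^ 2))

/-- All inputs, stacked. -/
def XAll (i : Fin K × Fin B) : 𝒳 := m.X i.1 i.2

/-- All observations, stacked. -/
def yAll (i : Fin K × Fin B) : ℝ := m.y i.1 i.2

/-- The batch collapsed bound `log N(y; 0, Q_{XX} + σ² I) - tr(D_{XX}) / (2σ²)`. -/
def LVFE : ℝ :=
  Real.log (gaussianPdf 0 (m.Q m.XAll + m.noise (Fin K × Fin B)) m.yAll) -
    (m.D m.XAll).trace / (2 * m.σ ^ 2)

/-- The uncollapsed bound
`-KL(q ‖ p) + ∑ k, ∫∫ q(u) p(f_k | u) log p(y_k | f_k) df_k du` for `q = N(ν, S)`. -/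
def LSVGP (ν : Fin M → ℝ) (S : Matrix (Fin M) (Fin M) ℝ) : EReal :=
  -((InformationTheory.klDiv
      (volume.withDensity fun u => ENNReal.ofReal (gaussianPdf ν S u))
      (volume.withDensity m.prior) : ℝ≥0∞) : EReal) +
    ∑ k : Fin K, extIntegral (m.joint k fun u => ENNReal.ofReal (gaussianPdf ν S u))
      fun z => ((Real.log (m.lik k z.2) : ℝ) : EReal)

end Model

end SparseGP

end

/-!
Everything rests on two facts.

*Bayes' rule for a linear Gaussian likelihood* (`gaussianPdf_mul_gaussianPdf`). Completing the
square, with the Woodbury and determinant identities for `H P Hᵀ + s I`, gives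
`N(y; H u, s I) N(u; μ, P) = N(y; H μ, H P Hᵀ + s I) N(u; μ', P')` pointwise in `u`. It yields the
recursive and Kalman forms of the update, and, read backwards through all mini-batches, the identity
`sum_log_bayes_update` between the product of the likelihoods with the prior and the final Gaussian.
The same product seen as a single batch has the normalizing constant of the batch bound; since both
Gaussians integrate to one (`lintegral_gaussianPdf`), the two collapsed bounds agree
(`LREC_eq_LVFE`).

*The bounds are constants minus Kullback–Leibler divergences* (`term_qStar_eq`, `LSVGP_eq`). The
expectation of `log p(y_k | f_k)` under `p(f_k | u)` is `log N(y_k; H_k u, σ² I)` minus the trace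
term, so integrating out `f_k` and applying Bayes' rule turns the `k`-th summand of the bound into
its optimal value minus `KL(q ‖ q_k^*)`, and the uncollapsed bound into the collapsed one minus
`KL(q ‖ q_K^*)`. Maximality, uniqueness and the comparison of the bounds are then the statement that
the divergence is nonnegative and vanishes only for equal laws.

The competitor `q` may have infinite second moments, so these integrals take values in `[-∞, ∞)`.
All integrands have integrable positive part (`UpperIntegrable`), because the likelihood is bounded
and `log x ≤ x`. For such functions the extended integral is additive (`extIntegral_add`) and obeys
Fubini's theorem (`extIntegral_compProd`), so no moment of `q` is ever needed.

The evidence is handled without computing it. It telescopes by definition (`evidence_succ`), and the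
two lower bounds on it are Jensen's inequality for the extended logarithm (`extIntegral_log_le`) and
Jensen's inequality within each mini-batch (`exp_expLogLik_le_condLik`).
-/

noncomputable section

namespace SparseGP

/-! ### Covariance identities for linear Gaussian conditioning -/

section LinearAlgebra

variable {ι n : Type*} [Fintype ι] [Fintype n]

/-- The precision `P⁻¹ + s⁻¹ HᵀH` of the posterior, for prior covariance `P` and noise variance
`s`. -/
def postPrec [DecidableEq n] (s : ℝ) (H : Matrix ι n ℝ) (P : Matrix n n ℝ) : Matrix n n ℝ :=
  P⁻¹ + s⁻¹ • (Hᵀ * H)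

/-- The covariance `H P Hᵀ + s I` of the predictive distribution. -/
def predCov [DecidableEq ι] (s : ℝ) (H : Matrix ι n ℝ) (P : Matrix n n ℝ) : Matrix ι ι ℝ :=
  H * P * Hᵀ + s • (1 : Matrix ι ι ℝ)

variable {s : ℝ} {H : Matrix ι n ℝ} {P : Matrix n n ℝ}

lemma predCov_posDef [DecidableEq ι] (hs : 0 < s) (hP : P.PosDef) : (predCov s H P).PosDef := by
  refine Matrix.PosDef.posSemidef_add ?_ (Matrix.PosDef.one.smul hs)
  simpa using hP.posSemidef.mul_mul_conjTranspose_same H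

lemma postPrec_posDef [DecidableEq n] (hs : 0 < s) (hP : P.PosDef) : (postPrec s H P).PosDef := by
  refine hP.inv.add_posSemidef (Matrix.PosSemidef.smul ?_ (inv_nonneg.2 hs.le))
  simpa using Matrix.posSemidef_conjTranspose_mul_self H

lemma postPrec_mul_mul_transpose [DecidableEq ι] [DecidableEq n] (hs : 0 < s) (hP : P.PosDef) :
    postPrec s H P * (P * Hᵀ) = s⁻¹ • (Hᵀ * predCov s H P) := by
  rw [postPrec, predCov, Matrix.add_mul, ← Matrix.mul_assoc P⁻¹, Matrix.nonsing_inv_mul _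
    ((Matrix.isUnit_iff_isUnit_det _).1 hP.isUnit), Matrix.mul_add, smul_add, add_comm]
  simp [Matrix.mul_assoc, smul_smul, inv_mul_cancel₀ hs.ne']

/-- The gain `P Hᵀ S⁻¹`, where `S` is the predictive covariance, in terms of the posterior
covariance. -/
lemma gain_eq [DecidableEq ι] [DecidableEq n] (hs : 0 < s) (hP : P.PosDef) :
    P * Hᵀ * (predCov s H P)⁻¹ = s⁻¹ • ((postPrec s H P)⁻¹ * Hᵀ) := by
  have hS := (Matrix.isUnit_iff_isUnit_det _).1 (predCov_posDef (H := H) hs hP).isUnit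
  have hL := (Matrix.isUnit_iff_isUnit_det _).1 (postPrec_posDef (H := H) hs hP).isUnit
  have h : P * Hᵀ = (postPrec s H P)⁻¹ * (s⁻¹ • (Hᵀ * predCov s H P)) := by
    rw [← postPrec_mul_mul_transpose hs hP, Matrix.nonsing_inv_mul_cancel_left _ _ hL]
  rw [h, Matrix.mul_smul, Matrix.smul_mul, ← Matrix.mul_assoc,
    Matrix.mul_nonsing_inv_cancel_right _ _ hS]

lemma postPrec_inv_transpose [DecidableEq n] (hs : 0 < s) (hP : P.PosDef) :
    ((postPrec s H P)⁻¹)ᵀ = (postPrec s H P)⁻¹ := by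
  simpa using (postPrec_posDef (H := H) hs hP).inv.isHermitian.eq

/-- The Woodbury form of the posterior covariance. -/
lemma postPrec_inv_eq [DecidableEq ι] [DecidableEq n] (hs : 0 < s) (hP : P.PosDef) :
    (postPrec s H P)⁻¹ = P - P * Hᵀ * (predCov s H P)⁻¹ * predCov s H P *
      (P * Hᵀ * (predCov s H P)⁻¹)ᵀ := by
  have hS := (Matrix.isUnit_iff_isUnit_det _).1 (predCov_posDef (H := H) hs hP).isUnit
  have hL := (Matrix.isUnit_iff_isUnit_det _).1 (postPrec_posDef (H := H) hs hP).isUnit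
  have hP' := (Matrix.isUnit_iff_isUnit_det _).1 hP.isUnit
  rw [Matrix.nonsing_inv_mul_cancel_right _ _ hS, gain_eq hs hP, eq_sub_iff_add_eq,
    Matrix.transpose_smul, Matrix.transpose_mul, postPrec_inv_transpose hs hP,
    Matrix.transpose_transpose]
  have : P * (postPrec s H P * (postPrec s H P)⁻¹) = P := by
    rw [Matrix.mul_nonsing_inv _ hL, Matrix.mul_one]
  conv_rhs => rw [← this]
  rw [← Matrix.mul_assoc P, postPrec, Matrix.mul_add, Matrix.mul_nonsing_inv _ hP',
    Matrix.add_mul, Matrix.one_mul]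
  simp [Matrix.mul_assoc]

/-- The Woodbury form of the inverse predictive covariance. -/
lemma predCov_inv_eq [DecidableEq ι] [DecidableEq n] (hs : 0 < s) (hP : P.PosDef) :
    (predCov s H P)⁻¹ =
      s⁻¹ • (1 : Matrix ι ι ℝ) - s⁻¹ • (s⁻¹ • (H * (postPrec s H P)⁻¹ * Hᵀ)) := by
  have hS := (Matrix.isUnit_iff_isUnit_det _).1 (predCov_posDef (H := H) hs hP).isUnit
  have h : predCov s H P * (predCov s H P)⁻¹ = 1 := Matrix.mul_nonsing_inv _ hS
  nth_rw 1 [predCov] at h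
  rw [Matrix.add_mul, Matrix.mul_assoc H, Matrix.mul_assoc H, gain_eq hs hP, Matrix.smul_mul,
    Matrix.one_mul] at h
  rw [← smul_sub, eq_inv_smul_iff₀ hs.ne', eq_sub_iff_add_eq, add_comm, ← h, Matrix.mul_smul,
    Matrix.mul_assoc]

/-- The determinant identity behind the normalizing constants in Bayes' rule, from
`det (1 + A B) = det (1 + B A)`. -/
lemma det_predCov_mul [DecidableEq ι] [DecidableEq n] (hs : 0 < s) (hP : P.PosDef) :
    (predCov s H P).det * ((postPrec s H P)⁻¹).det = (s • (1 : Matrix ι ι ℝ)).det * P.det := by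
  have hL := (Matrix.isUnit_iff_isUnit_det _).1 (postPrec_posDef (H := H) hs hP).isUnit
  have hP' := (Matrix.isUnit_iff_isUnit_det _).1 hP.isUnit
  have h1 : predCov s H P = s • (1 + H * (s⁻¹ • (P * Hᵀ))) := by
    simp [predCov, smul_add, smul_smul, mul_inv_cancel₀ hs.ne', Matrix.mul_assoc, add_comm]
  have h2 : (1 : Matrix n n ℝ) + s⁻¹ • (P * Hᵀ) * H = P * postPrec s H P := by
    simp [postPrec, Matrix.mul_add, Matrix.mul_nonsing_inv _ hP', Matrix.mul_assoc]
  rw [h1, Matrix.det_smul, Matrix.det_one_add_mul_comm, h2, Matrix.det_mul, Matrix.det_smul,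
    Matrix.det_one, Matrix.det_nonsing_inv, mul_one, mul_assoc, mul_assoc,
    Ring.mul_inverse_cancel _ hL, mul_one]

/-- The posterior mean in innovation form. -/
lemma postMean_eq [DecidableEq ι] [DecidableEq n] (hs : 0 < s) (hP : P.PosDef) (y : ι → ℝ)
    (μ : n → ℝ) :
    (postPrec s H P)⁻¹ *ᵥ (s⁻¹ • (Hᵀ *ᵥ y) + P⁻¹ *ᵥ μ) =
      μ + (P * Hᵀ * (predCov s H P)⁻¹) *ᵥ (y - H *ᵥ μ) := by
  have hL := (Matrix.isUnit_iff_isUnit_det _).1 (postPrec_posDef (H := H) hs hP).isUnit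
  have h : P⁻¹ *ᵥ μ = postPrec s H P *ᵥ μ - s⁻¹ • (Hᵀ *ᵥ (H *ᵥ μ)) := by
    simp [postPrec, Matrix.add_mulVec, Matrix.smul_mulVec]
  have h2 : s⁻¹ • (Hᵀ *ᵥ y) + P⁻¹ *ᵥ μ =
      postPrec s H P *ᵥ μ + s⁻¹ • (Hᵀ *ᵥ (y - H *ᵥ μ)) := by
    rw [h, Matrix.mulVec_sub, smul_sub]; abel
  rw [h2, Matrix.mulVec_add, Matrix.mulVec_mulVec, Matrix.nonsing_inv_mul _ hL, Matrix.one_mulVec,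
    gain_eq hs hP, Matrix.mulVec_smul, Matrix.mulVec_mulVec, Matrix.smul_mulVec]

end LinearAlgebra

/-! ### The Gaussian density -/

section GaussianDensity

variable {ι n : Type*} [Fintype ι] [DecidableEq ι] [Fintype n] [DecidableEq n]

lemma gaussianPdf_pos {S : Matrix n n ℝ} (hS : S.PosDef) (m x : n → ℝ) :
    0 < gaussianPdf m S x := by
  have := hS.det_pos
  unfold gaussianPdf
  positivity

@[fun_prop]
lemma continuous_gaussianPdf (m : n → ℝ) (S : Matrix n n ℝ) : Continuous (gaussianPdf m S) := by
  unfold gaussianPdf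
  fun_prop

@[fun_prop]
lemma continuous_gaussianPdf_mean (S : Matrix n n ℝ) (x : n → ℝ) :
    Continuous fun m => gaussianPdf m S x := by
  unfold gaussianPdf
  fun_prop

lemma gaussianPdf_le {S : Matrix n n ℝ} (hS : S.PosDef) (m x : n → ℝ) :
    gaussianPdf m S x ≤ (√((2 * Real.pi) ^ Fintype.card n * S.det))⁻¹ := by
  have h : 0 ≤ (x - m) ⬝ᵥ (S⁻¹ *ᵥ (x - m)) := by
    simpa using hS.inv.posSemidef.dotProduct_mulVec_nonneg (x - m)
  exact mul_le_of_le_one_right (by positivity) (Real.exp_le_one_iff.2 (by linarith))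

/-- A Gaussian density with covariance `s I` is a product of one-dimensional ones. -/
lemma gaussianPdf_smul_one {s : ℝ} (hs : 0 < s) (m x : n → ℝ) :
    gaussianPdf m (s • (1 : Matrix n n ℝ)) x =
      ∏ i, (√(2 * Real.pi * s))⁻¹ * Real.exp (-(1 / 2) * (s⁻¹ * (x i - m i) ^ 2)) := by
  have hinv : (s • (1 : Matrix n n ℝ))⁻¹ = s⁻¹ • 1 :=
    Matrix.inv_eq_left_inv (by simp [smul_smul, mul_inv_cancel₀ hs.ne'])
  rw [Finset.prod_mul_distrib, ← Real.exp_sum, ← Finset.mul_sum, ← Finset.mul_sum, gaussianPdf,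
    hinv, Finset.prod_const, Finset.card_univ, inv_pow]
  congr 2
  · rw [Matrix.det_smul, Matrix.det_one, mul_one, ← mul_pow, Real.sqrt_eq_iff_eq_sq (by positivity)
      (by positivity), ← pow_mul, mul_comm _ 2, pow_mul, Real.sq_sqrt (by positivity)]
  · rw [Matrix.smul_mulVec, Matrix.one_mulVec, dotProduct_smul, smul_eq_mul]
    simp [dotProduct, sq]

lemma lintegral_gaussianPdf_one :
    ∫⁻ u : n → ℝ, ENNReal.ofReal (gaussianPdf 0 1 u) = 1 := by
  have h : ∀ u : n → ℝ, gaussianPdf 0 1 u = ∏ i, gaussianPDFReal 0 1 (u i) := by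
    intro u
    have := gaussianPdf_smul_one one_pos 0 u
    rw [one_smul] at this
    rw [this]
    refine Finset.prod_congr rfl fun i _ => ?_
    simp only [gaussianPDFReal, NNReal.coe_one, mul_one, Pi.zero_apply, sub_zero, inv_one, one_mul]
    congr 2; ring
  rw [← ofReal_integral_eq_lintegral_ofReal]
  · simp_rw [h]
    rw [integral_fintype_prod_volume_eq_pow]
    simp [integral_gaussianPDFReal_eq_one]
  · rw [show gaussianPdf 0 1 = _ from funext h]
    exact Integrable.fintype_prod fun _ => integrable_gaussianPDFReal 0 1
  · exact .of_forall fun u => (gaussianPdf_pos Matrix.PosDef.one 0 u).le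

/-- The Gaussian density is normalized: the substitution `u = m + S^{1/2} z` reduces it to the
standard one. -/
lemma lintegral_gaussianPdf {S : Matrix n n ℝ} (hS : S.PosDef) (m : n → ℝ) :
    ∫⁻ u : n → ℝ, ENNReal.ofReal (gaussianPdf m S u) = 1 := by
  set A := CFC.sqrt S with hA
  have hAA : A * A = S := CFC.sqrt_mul_sqrt_self _ hS.posSemidef.nonneg
  have hAT : Aᵀ = A := by
    simpa using (Matrix.nonneg_iff_posSemidef.1 (CFC.sqrt_nonneg S)).isHermitian.eq
  have hdet : A.det * A.det = S.det := by rw [← Matrix.det_mul, hAA]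
  have hpos := hS.det_pos
  have hdet0 : A.det ≠ 0 := by rintro h; rw [h] at hdet; simp at hdet; linarith
  have hshift : ∀ u, gaussianPdf m S u = gaussianPdf 0 S (u - m) := by
    intro u; simp [gaussianPdf]
  simp_rw [hshift]
  rw [lintegral_sub_right_eq_self (fun u => ENNReal.ofReal (gaussianPdf 0 S u)) m]
  have hz : ∀ z, gaussianPdf 0 1 z = |A.det| * gaussianPdf 0 S (A *ᵥ z) := by
    intro z
    have hq : A *ᵥ z ⬝ᵥ S⁻¹ *ᵥ (A *ᵥ z) = z ⬝ᵥ z := by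
      have hu : IsUnit A.det := isUnit_iff_ne_zero.2 hdet0
      have : A *ᵥ z = z ᵥ* A := by rw [← Matrix.mulVec_transpose, hAT]
      nth_rw 1 [this]
      rw [← Matrix.dotProduct_mulVec, Matrix.mulVec_mulVec, Matrix.mulVec_mulVec, ← hAA,
        Matrix.mul_inv_rev, ← Matrix.mul_assoc, Matrix.mul_assoc, Matrix.mul_assoc,
        Matrix.nonsing_inv_mul _ hu, Matrix.mul_one, Matrix.mul_nonsing_inv _ hu, Matrix.one_mulVec]
    have hd : √S.det = |A.det| := by rw [← hdet, Real.sqrt_mul_self_eq_abs]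
    simp only [gaussianPdf, sub_zero, hq, inv_one, Matrix.one_mulVec, Matrix.det_one, mul_one]
    rw [Real.sqrt_mul (by positivity), hd, mul_inv]
    field_simp
  have hmap := Real.map_matrix_volume_pi_eq_smul_volume_pi hdet0
  have h1 := lintegral_gaussianPdf_one (n := n)
  have hmeas : Measurable fun u : n → ℝ => ENNReal.ofReal (gaussianPdf 0 S u) := by fun_prop
  have h2 := lintegral_map (μ := volume) hmeas
    (show Measurable (Matrix.toLin' A) from
      (LinearMap.continuous_of_finiteDimensional _).measurable)
  rw [hmap, lintegral_smul_measure] at h2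
  simp_rw [hz, ENNReal.ofReal_mul (abs_nonneg _)] at h1
  rw [lintegral_const_mul _ (by fun_prop)] at h1
  simp only [Matrix.toLin'_apply] at h2
  rw [← h2, smul_eq_mul, ← mul_assoc, ← ENNReal.ofReal_mul (abs_nonneg _), ← abs_mul,
    mul_inv_cancel₀ hdet0] at h1
  simpa using h1

/-- Bayes' rule for a Gaussian prior and a linear Gaussian likelihood: completing the square. -/
lemma gaussianPdf_mul_gaussianPdf {s : ℝ} (hs : 0 < s) {P : Matrix n n ℝ} (hP : P.PosDef)
    (H : Matrix ι n ℝ) (y : ι → ℝ) (μ u : n → ℝ) :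
    gaussianPdf (H *ᵥ u) (s • (1 : Matrix ι ι ℝ)) y * gaussianPdf μ P u =
      gaussianPdf (H *ᵥ μ) (predCov s H P) y *
        gaussianPdf ((postPrec s H P)⁻¹ *ᵥ (s⁻¹ • (Hᵀ *ᵥ y) + P⁻¹ *ᵥ μ)) (postPrec s H P)⁻¹ u := by
  have hL := (Matrix.isUnit_iff_isUnit_det _).1 (postPrec_posDef (H := H) hs hP).isUnit
  have hpost := (postPrec_posDef (H := H) hs hP).inv.det_pos
  have hpred := (predCov_posDef (H := H) hs hP).det_pos
  have hpri := hP.det_pos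
  have hno := (Matrix.PosDef.one (n := ι) (R := ℝ)).smul hs |>.det_pos
  have hinv : (s • (1 : Matrix ι ι ℝ))⁻¹ = s⁻¹ • 1 :=
    Matrix.inv_eq_left_inv (by simp [smul_smul, mul_inv_cancel₀ hs.ne'])
  rw [postMean_eq hs hP, gain_eq hs hP]
  simp only [gaussianPdf]
  have hc : (√((2 * Real.pi) ^ Fintype.card ι * (s • (1 : Matrix ι ι ℝ)).det))⁻¹ *
      (√((2 * Real.pi) ^ Fintype.card n * P.det))⁻¹ =
      (√((2 * Real.pi) ^ Fintype.card ι * (predCov s H P).det))⁻¹ *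
      (√((2 * Real.pi) ^ Fintype.card n * ((postPrec s H P)⁻¹).det))⁻¹ := by
    rw [← mul_inv, ← mul_inv, ← Real.sqrt_mul (by positivity), ← Real.sqrt_mul (by positivity)]
    congr 2
    linear_combination -(2 * Real.pi) ^ Fintype.card ι * (2 * Real.pi) ^ Fintype.card n *
      det_predCov_mul (H := H) hs hP
  rw [mul_mul_mul_comm, mul_mul_mul_comm _ _ (√_)⁻¹, hc, ← Real.exp_add, ← Real.exp_add]
  congr 2
  rw [← mul_add, ← mul_add]
  congr 1
  -- in the innovation `r` and the deviation `v` from the prior mean, both exponents become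
  -- polynomials in a few bilinear expressions
  set r := y - H *ᵥ μ with hr
  set v := u - μ with hv
  set L := postPrec s H P with hLdef
  have e1 : y - H *ᵥ u = r - H *ᵥ v := by rw [hr, hv, Matrix.mulVec_sub]; abel
  have e2 : u - (μ + (s⁻¹ • (L⁻¹ * Hᵀ)) *ᵥ r) = v - s⁻¹ • (L⁻¹ *ᵥ (Hᵀ *ᵥ r)) := by
    rw [hv, Matrix.smul_mulVec, Matrix.mulVec_mulVec]; abel
  rw [e1, e2, hinv, predCov_inv_eq hs hP, Matrix.nonsing_inv_nonsing_inv _ hL, ← hLdef]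
  set t := Hᵀ *ᵥ r with ht
  have hLT : Lᵀ = L := by simpa using (postPrec_posDef (H := H) hs hP).isHermitian.eq
  have e3 : v ⬝ᵥ L *ᵥ v = v ⬝ᵥ P⁻¹ *ᵥ v + s⁻¹ * (H *ᵥ v ⬝ᵥ H *ᵥ v) := by
    rw [hLdef, postPrec, Matrix.add_mulVec, dotProduct_add, Matrix.smul_mulVec, dotProduct_smul,
      ← Matrix.mulVec_mulVec, Matrix.dotProduct_mulVec v Hᵀ, Matrix.vecMul_transpose, smul_eq_mul]
  have e4 : r ⬝ᵥ H *ᵥ v = v ⬝ᵥ t := by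
    rw [ht, Matrix.dotProduct_mulVec v, Matrix.vecMul_transpose, dotProduct_comm]
  have e5 : L *ᵥ (L⁻¹ *ᵥ t) = t := by
    rw [Matrix.mulVec_mulVec, Matrix.mul_nonsing_inv _ hL, Matrix.one_mulVec]
  have e6 : (L⁻¹ *ᵥ t) ⬝ᵥ L *ᵥ v = t ⬝ᵥ v := by
    rw [Matrix.dotProduct_mulVec, ← Matrix.mulVec_transpose, hLT, e5]
  have e7 : r ⬝ᵥ (H * L⁻¹ * Hᵀ) *ᵥ r = t ⬝ᵥ L⁻¹ *ᵥ t := by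
    rw [← Matrix.mulVec_mulVec, ← Matrix.mulVec_mulVec, Matrix.dotProduct_mulVec r H, ht,
      ← Matrix.mulVec_transpose H]
  simp only [Matrix.sub_mulVec, Matrix.smul_mulVec, Matrix.one_mulVec, dotProduct_smul,
    dotProduct_sub, sub_dotProduct, smul_dotProduct, Matrix.mulVec_sub, Matrix.mulVec_smul,
    smul_eq_mul, e3, e4, e5, e6, e7, dotProduct_comm (H *ᵥ v) r, dotProduct_comm t v,
    dotProduct_comm (L⁻¹ *ᵥ t) t]
  ring

end GaussianDensity

/-! ### Extended integrals of functions with integrable positive part -/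

section ExtIntegral

variable {α β : Type*} [MeasurableSpace α] [MeasurableSpace β]

/-- A measurable real function whose positive part has finite integral, so that its integral is a
well-defined element of `[-∞, ∞)`. -/
def UpperIntegrable (f : α → ℝ) (P : Measure α) : Prop :=
  AEStronglyMeasurable f P ∧ ∫⁻ x, ENNReal.ofReal (f x) ∂P ≠ ∞

variable {P : Measure α} {f g : α → ℝ}

lemma _root_.MeasureTheory.Integrable.upperIntegrable (hf : Integrable f P) :
    UpperIntegrable f P :=
  ⟨hf.1, hf.lintegral_lt_top.ne⟩

lemma UpperIntegrable.mono (hg : UpperIntegrable g P) (hf : AEStronglyMeasurable f P)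
    (hfg : f ≤ᵐ[P] g) : UpperIntegrable f P :=
  ⟨hf, ne_top_of_le_ne_top hg.2 <| lintegral_mono_ae <| by
    filter_upwards [hfg] with x hx using ENNReal.ofReal_le_ofReal hx⟩

lemma UpperIntegrable.add (hf : UpperIntegrable f P) (hg : UpperIntegrable g P) :
    UpperIntegrable (fun x => f x + g x) P := by
  refine ⟨hf.1.add hg.1, ne_top_of_le_ne_top ?_
    (lintegral_mono fun x => ENNReal.ofReal_add_le (p := f x) (q := g x))⟩
  rw [lintegral_add_left' hf.1.aemeasurable.ennreal_ofReal]
  exact ENNReal.add_ne_top.2 ⟨hf.2, hg.2⟩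

lemma UpperIntegrable.integrable (hf : UpperIntegrable f P)
    (h : ∫⁻ x, ENNReal.ofReal (-f x) ∂P ≠ ∞) : Integrable f P := by
  refine ⟨hf.1, ?_⟩
  rw [hasFiniteIntegral_iff_enorm]
  have h1 : ∀ x, ‖f x‖ₑ = ENNReal.ofReal (f x) + ENNReal.ofReal (-f x) := by
    intro x
    rw [Real.enorm_eq_ofReal_abs]
    rcases le_total 0 (f x) with h | h
    · simp [abs_of_nonneg h, ENNReal.ofReal_of_nonpos (neg_nonpos.2 h)]
    · simp [abs_of_nonpos h, ENNReal.ofReal_of_nonpos h]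
  simp_rw [h1]
  rw [lintegral_add_left' hf.1.aemeasurable.ennreal_ofReal]
  exact (ENNReal.add_ne_top.2 ⟨hf.2, h⟩).lt_top

lemma extIntegral_congr_ae {f g : α → EReal} (h : f =ᵐ[P] g) :
    extIntegral P f = extIntegral P g := by
  unfold extIntegral
  rw [lintegral_congr_ae (g := fun x => (g x).toENNReal),
    lintegral_congr_ae (f := fun x => (-f x).toENNReal) (g := fun x => (-g x).toENNReal)]
  all_goals
    filter_upwards [h] with x hx
    rw [hx]

lemma extIntegral_coe (f : α → ℝ) : extIntegral P (fun x => (f x : EReal)) =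
    ((∫⁻ x, ENNReal.ofReal (f x) ∂P : ℝ≥0∞) : EReal) -
      ((∫⁻ x, ENNReal.ofReal (-f x) ∂P : ℝ≥0∞) : EReal) := by
  simp only [extIntegral, ← EReal.coe_neg, EReal.real_coe_toENNReal]

lemma extIntegral_of_integrable (hf : Integrable f P) :
    extIntegral P (fun x => (f x : EReal)) = ((∫ x, f x ∂P : ℝ) : EReal) := by
  rw [extIntegral_coe, integral_eq_lintegral_pos_part_sub_lintegral_neg_part hf, EReal.coe_sub,
    EReal.coe_ennreal_toReal, EReal.coe_ennreal_toReal]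
  · exact hf.neg.lintegral_lt_top.ne
  · exact hf.lintegral_lt_top.ne

lemma extIntegral_of_not_integrable (hf : UpperIntegrable f P) (h : ¬ Integrable f P) :
    extIntegral P (fun x => (f x : EReal)) = ⊥ := by
  have : ∫⁻ x, ENNReal.ofReal (-f x) ∂P = ∞ := by
    by_contra h'
    exact h (hf.integrable h')
  rw [extIntegral_coe, this]
  simp

lemma extIntegral_add (hf : UpperIntegrable f P) (hg : UpperIntegrable g P) :
    extIntegral P (fun x => ((f x + g x : ℝ) : EReal)) =
      extIntegral P (fun x => (f x : EReal)) + extIntegral P (fun x => (g x : EReal)) := by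
  -- if a sum is integrable and both positive parts are, then so is each summand
  have key : ∀ f g : α → ℝ, UpperIntegrable f P → UpperIntegrable g P →
      Integrable (fun x => f x + g x) P → Integrable f P := by
    intro f g hf hg h
    refine hf.integrable (ne_top_of_le_ne_top (ENNReal.add_ne_top.2
      ⟨h.neg.lintegral_lt_top.ne, hg.2⟩) ?_)
    rw [← lintegral_add_right' _ hg.1.aemeasurable.ennreal_ofReal]
    refine lintegral_mono fun x => ?_
    refine le_trans (ENNReal.ofReal_le_ofReal ?_) (ENNReal.ofReal_add_le)
    simp
  by_cases h : Integrable (fun x => f x + g x) P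
  · have h1 := key f g hf hg h
    have h2 := key g f hg hf (by simpa only [add_comm] using h)
    rw [extIntegral_of_integrable h, extIntegral_of_integrable h1, extIntegral_of_integrable h2,
      integral_add h1 h2, EReal.coe_add]
  · rw [extIntegral_of_not_integrable (hf.add hg) h]
    by_cases h1 : Integrable f P
    · rw [extIntegral_of_not_integrable hg fun h2 => h (h1.add h2), EReal.add_bot]
    · rw [extIntegral_of_not_integrable hf h1, EReal.bot_add]

lemma UpperIntegrable.sum {κ : Type*} {f : κ → α → ℝ} (s : Finset κ)
    (hf : ∀ k, UpperIntegrable (f k) P) : UpperIntegrable (fun x => ∑ k ∈ s, f k x) P := by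
  classical
  induction s using Finset.induction_on with
  | empty => exact (integrable_zero α ℝ P).upperIntegrable
  | insert k s hk ih => simpa only [Finset.sum_insert hk] using (hf k).add ih

lemma extIntegral_sum {κ : Type*} {f : κ → α → ℝ} (s : Finset κ)
    (hf : ∀ k, UpperIntegrable (f k) P) :
    extIntegral P (fun x => ((∑ k ∈ s, f k x : ℝ) : EReal)) =
      ∑ k ∈ s, extIntegral P (fun x => (f k x : EReal)) := by
  classical
  induction s using Finset.induction_on with
  | empty => simp [extIntegral]
  | insert k s hk ih =>
    simp only [Finset.sum_insert hk]
    rw [extIntegral_add (hf k) (UpperIntegrable.sum s hf), ih]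

/-- Fubini's theorem for functions with integrable positive part. If the iterated integral is finite
then so is the joint one, since the negative part on each fibre is the positive part minus the
fibre integral. -/
lemma extIntegral_compProd [SFinite P] {κ : Kernel α β} [IsSFiniteKernel κ] {g : α × β → ℝ}
    (hg : Measurable g) (hup : UpperIntegrable g (P ⊗ₘ κ)) {h : α → ℝ} (hmeas : Measurable h)
    (hint : ∀ x, Integrable (fun y => g (x, y)) (κ x))
    (hh : ∀ x, ∫ y, g (x, y) ∂κ x = h x) :
    UpperIntegrable h P ∧
      extIntegral (P ⊗ₘ κ) (fun z => (g z : EReal)) = extIntegral P (fun x => (h x : EReal)) := by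
  have hpos := Measure.lintegral_compProd (μ := P) (κ := κ) hg.ennreal_ofReal
  have hneg : ∫⁻ z, ENNReal.ofReal (-g z) ∂(P ⊗ₘ κ) =
      ∫⁻ x, ∫⁻ y, ENNReal.ofReal (-g (x, y)) ∂κ x ∂P :=
    Measure.lintegral_compProd hg.neg.ennreal_ofReal
  have hle : ∀ x, ENNReal.ofReal (h x) ≤ ∫⁻ y, ENNReal.ofReal (g (x, y)) ∂κ x := by
    intro x
    rw [← hh x, integral_eq_lintegral_pos_part_sub_lintegral_neg_part (hint x)]
    exact ENNReal.ofReal_le_of_le_toReal (sub_le_self _ ENNReal.toReal_nonneg)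
  have hle' : ∀ x, ∫⁻ y, ENNReal.ofReal (-g (x, y)) ∂κ x ≤
      ∫⁻ y, ENNReal.ofReal (g (x, y)) ∂κ x + ENNReal.ofReal (-h x) := by
    intro x
    have h1 := (hint x).lintegral_lt_top.ne
    have h2 := (hint x).neg.lintegral_lt_top.ne
    rw [← hh x, integral_eq_lintegral_pos_part_sub_lintegral_neg_part (hint x)]
    rw [← ENNReal.ofReal_toReal h1]
    refine (le_of_eq (ENNReal.ofReal_toReal h2).symm).trans
      ((ENNReal.ofReal_le_ofReal ?_).trans ENNReal.ofReal_add_le)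
    rw [ENNReal.toReal_ofReal ENNReal.toReal_nonneg]
    simp
  have huph : UpperIntegrable h P :=
    ⟨hmeas.aestronglyMeasurable, ne_top_of_le_ne_top hup.2 (hpos ▸ lintegral_mono hle)⟩
  refine ⟨huph, ?_⟩
  by_cases hi : Integrable g (P ⊗ₘ κ)
  · have hi' : Integrable h P :=
      (Integrable.integral_compProd (κ := Kernel.const Unit P) (a := ())
        (η := Kernel.prodMkLeft Unit κ) hi).congr (.of_forall fun x => hh x)
    rw [extIntegral_of_integrable hi, extIntegral_of_integrable hi', Measure.integral_compProd hi]
    simp_rw [hh]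
  · rw [extIntegral_of_not_integrable hup hi, extIntegral_of_not_integrable huph]
    intro hi'
    refine hi (hup.integrable ?_)
    rw [hneg]
    refine ne_top_of_le_ne_top (ENNReal.add_ne_top.2 ⟨hup.2, hi'.neg.lintegral_lt_top.ne⟩)
      ((lintegral_mono hle').trans ?_)
    have hm : Measurable fun x => ENNReal.ofReal (-h x) := hmeas.neg.ennreal_ofReal
    rw [lintegral_add_right _ hm, hpos]
    rfl

/-- Jensen's inequality for the logarithm, with values in `[-∞, ∞]`. -/
lemma extIntegral_log_le [IsProbabilityMeasure P] {w : α → ℝ≥0∞} (hw : Measurable w) :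
    extIntegral P (fun x => ENNReal.log (w x)) ≤ ENNReal.log (∫⁻ x, w x ∂P) := by
  set Z := ∫⁻ x, w x ∂P with hZ
  by_cases htop : Z = ∞
  · simp [htop]
  have hlt : ∀ᵐ x ∂P, w x < ∞ := ae_lt_top hw htop
  by_cases h0 : ∀ᵐ x ∂P, w x ≠ 0
  · have hZ0 : Z ≠ 0 := by
      intro h
      rw [hZ, lintegral_eq_zero_iff hw] at h
      have : ∀ᵐ x ∂P, False := by
        filter_upwards [h, h0] with x h1 h2 using h2 h1
      exact IsProbabilityMeasure.ne_zero P (by simpa using this)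
    have hZpos : 0 < Z.toReal := ENNReal.toReal_pos hZ0 htop
    have hcongr : (fun x => ENNReal.log (w x)) =ᵐ[P]
        fun x => ((Real.log (w x).toReal : ℝ) : EReal) := by
      filter_upwards [hlt, h0] with x h1 h2 using ENNReal.log_pos_real h2 h1.ne
    rw [extIntegral_congr_ae hcongr, ENNReal.log_pos_real hZ0 htop]
    have hwint : Integrable (fun x => (w x).toReal) P :=
      integrable_toReal_of_lintegral_ne_top hw.aemeasurable htop
    have hbint : Integrable (fun x => Real.log Z.toReal + ((w x).toReal / Z.toReal - 1)) P :=
      (integrable_const _).add ((hwint.div_const _).sub (integrable_const _))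
    -- the tangent to `log` at the mean `Z`
    have hle : ∀ᵐ x ∂P, Real.log (w x).toReal ≤
        Real.log Z.toReal + ((w x).toReal / Z.toReal - 1) := by
      filter_upwards [hlt, h0] with x h1 h2
      have hx : 0 < (w x).toReal := ENNReal.toReal_pos h2 h1.ne
      have := Real.log_le_sub_one_of_pos (div_pos hx hZpos)
      rw [Real.log_div hx.ne' hZpos.ne'] at this
      linarith
    have hm : AEStronglyMeasurable (fun x => Real.log (w x).toReal) P :=
      (Real.measurable_log.comp hw.ennreal_toReal).aestronglyMeasurable
    by_cases hi : Integrable (fun x => Real.log (w x).toReal) P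
    · rw [extIntegral_of_integrable hi, EReal.coe_le_coe_iff]
      refine (integral_mono_ae hi hbint hle).trans (le_of_eq ?_)
      have hsub : Integrable (fun x => (w x).toReal / Z.toReal - 1) P :=
        (hwint.div_const _).sub (integrable_const _)
      rw [integral_add (integrable_const _) hsub,
        integral_sub (hwint.div_const _) (integrable_const _), integral_div,
        integral_toReal hw.aemeasurable hlt, ← hZ, div_self hZpos.ne']
      simp
    · rw [extIntegral_of_not_integrable (hbint.upperIntegrable.mono hm hle) hi]
      exact bot_le
  · -- the integrand is `-∞` on a set of positive measure
    have hneg : ∫⁻ x, (-(ENNReal.log (w x))).toENNReal ∂P = ∞ := by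
      by_contra hne
      have hm : Measurable fun x => (-(ENNReal.log (w x))).toENNReal := by
        have := ENNReal.measurable_log.comp hw
        fun_prop
      refine h0 ?_
      filter_upwards [ae_lt_top hm hne] with x hx h
      simp [h] at hx
    simp [extIntegral, hneg]

end ExtIntegral

/-! ### Kullback–Leibler divergence between densities -/

section Densities

variable {M : ℕ} {q r : (Fin M → ℝ) → ℝ≥0∞}

lemma IsDensity.isProbabilityMeasure (hq : IsDensity q) :
    IsProbabilityMeasure (volume.withDensity q) :=
  ⟨by rw [withDensity_apply _ MeasurableSet.univ, Measure.restrict_univ, hq.2]⟩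

lemma IsDensity.ae_ne_zero (hq : IsDensity q) : ∀ᵐ u ∂volume.withDensity q, q u ≠ 0 := by
  rw [ae_withDensity_iff hq.1]
  exact .of_forall fun _ h => h

lemma IsDensity.ae_ne_top (hq : IsDensity q) : ∀ᵐ u ∂volume.withDensity q, q u ≠ ∞ := by
  refine (withDensity_absolutelyContinuous _ _).ae_le ?_
  filter_upwards [ae_lt_top hq.1 (by simp [hq.2])] with u hu using hu.ne

/-- Only an inequality, since the left side does not see the mass of `r` where `q` vanishes. -/
lemma lintegral_div_withDensity_le (hq : Measurable q) (hr : Measurable r) :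
    ∫⁻ u, r u / q u ∂volume.withDensity q ≤ ∫⁻ u, r u := by
  have h : Measurable fun u => r u / q u := hr.div hq
  rw [lintegral_withDensity_eq_lintegral_mul _ hq h]
  refine lintegral_mono fun u => ?_
  exact ENNReal.mul_div_le

lemma ae_withDensity_llr_eq (hq : IsDensity q) (hr : IsDensity r) (hr0 : ∀ u, r u ≠ 0) :
    ∀ᵐ u ∂volume.withDensity q, llr (volume.withDensity q) (volume.withDensity r) u =
      Real.log (q u).toReal - Real.log (r u).toReal := by
  have := hq.isProbabilityMeasure
  have := hr.isProbabilityMeasure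
  have hvr : (volume : Measure (Fin M → ℝ)) ≪ volume.withDensity r :=
    withDensity_absolutelyContinuous' hr.1.aemeasurable (.of_forall hr0)
  have hqv : volume.withDensity q ≪ volume := withDensity_absolutelyContinuous _ _
  have h1 := hqv.ae_le (hvr.ae_le (Measure.rnDeriv_eq_div hqv
    (withDensity_absolutelyContinuous (volume : Measure (Fin M → ℝ)) r)))
  have h2 := hqv.ae_le (Measure.rnDeriv_withDensity volume hq.1)
  have h3 := hqv.ae_le (Measure.rnDeriv_withDensity volume hr.1)
  have h4 := hqv.ae_le (ae_lt_top hr.1 (by simp [hr.2]))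
  filter_upwards [h1, h2, h3, h4, hq.ae_ne_zero, hq.ae_ne_top] with u h1 h2 h3 h4 h5 h6
  rw [llr, h1, h2, h3, ENNReal.toReal_div, Real.log_div]
  · exact (ENNReal.toReal_pos h5 h6).ne'
  · exact (ENNReal.toReal_pos (hr0 u) h4.ne).ne'

/-- The negative log-likelihood ratio has integrable positive part, as `log x ≤ x`. -/
lemma upperIntegrable_neg_llr (hq : IsDensity q) (hr : IsDensity r) (hr0 : ∀ u, r u ≠ 0) :
    UpperIntegrable (fun u => -llr (volume.withDensity q) (volume.withDensity r) u)
      (volume.withDensity q) := by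
  have hqv : volume.withDensity q ≪ volume := withDensity_absolutelyContinuous _ _
  have hint : Integrable (fun u => (r u / q u).toReal) (volume.withDensity q) :=
    integrable_toReal_of_lintegral_ne_top (hr.1.div hq.1).aemeasurable
      (ne_top_of_le_ne_top (by simp [hr.2]) (lintegral_div_withDensity_le hq.1 hr.1))
  refine hint.upperIntegrable.mono (measurable_llr _ _).neg.aestronglyMeasurable ?_
  filter_upwards [ae_withDensity_llr_eq hq hr hr0, hqv.ae_le (ae_lt_top hr.1 (by simp [hr.2])),
    hq.ae_ne_zero, hq.ae_ne_top] with u h1 h2 h3 h4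
  have hqp := ENNReal.toReal_pos h3 h4
  have hrp := ENNReal.toReal_pos (hr0 u) h2.ne
  have := Real.log_le_self (div_pos hrp hqp).le
  rw [Real.log_div hrp.ne' hqp.ne'] at this
  rw [h1, ENNReal.toReal_div]
  linarith

/-- The Kullback–Leibler divergence as an extended integral. -/
lemma extIntegral_neg_llr (hq : IsDensity q) (hr : IsDensity r) (hr0 : ∀ u, r u ≠ 0) :
    extIntegral (volume.withDensity q) (fun u =>
        ((-llr (volume.withDensity q) (volume.withDensity r) u : ℝ) : EReal)) =
      -((InformationTheory.klDiv (volume.withDensity q) (volume.withDensity r) : ℝ≥0∞) :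
        EReal) := by
  have := hq.isProbabilityMeasure
  have := hr.isProbabilityMeasure
  have hac : volume.withDensity q ≪ volume.withDensity r :=
    (withDensity_absolutelyContinuous _ _).trans
      (withDensity_absolutelyContinuous' hr.1.aemeasurable (.of_forall hr0))
  have hup := upperIntegrable_neg_llr hq hr hr0
  by_cases h : Integrable (llr (volume.withDensity q) (volume.withDensity r))
      (volume.withDensity q)
  · have hneg : Integrable (fun u => -llr (volume.withDensity q) (volume.withDensity r) u)
        (volume.withDensity q) := h.neg
    rw [extIntegral_of_integrable hneg, integral_neg,
      ← InformationTheory.toReal_klDiv_of_measure_eq hac (by simp),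
      EReal.coe_neg, EReal.coe_ennreal_toReal (InformationTheory.klDiv_ne_top hac h)]
  · rw [extIntegral_of_not_integrable hup fun h' => h (by simpa using h'.neg),
      InformationTheory.klDiv_of_not_integrable h]
    simp

/-- The free-energy form of Gibbs' variational principle. -/
lemma extIntegral_const_sub_llr (hq : IsDensity q) (hr : IsDensity r) (hr0 : ∀ u, r u ≠ 0)
    (c : ℝ) :
    extIntegral (volume.withDensity q) (fun u =>
        ((c + -llr (volume.withDensity q) (volume.withDensity r) u : ℝ) : EReal)) =
      c - ((InformationTheory.klDiv (volume.withDensity q) (volume.withDensity r) : ℝ≥0∞) :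
        EReal) := by
  have := hq.isProbabilityMeasure
  rw [extIntegral_add (integrable_const c).upperIntegrable (upperIntegrable_neg_llr hq hr hr0),
    extIntegral_of_integrable (integrable_const c), extIntegral_neg_llr hq hr hr0]
  simp [sub_eq_add_neg]

end Densities

/-! ### Telescoping sums and Gaussian moments -/

section Auxiliary

/-- A sequence whose successive differences are `r` telescopes. -/
lemma last_eq_add_sum {G : Type*} [AddCommMonoid G] : ∀ {K : ℕ} (f : Fin (K + 1) → G)
    (r : Fin K → G), (∀ k : Fin K, f k.succ = f k.castSucc + r k) →
    f (Fin.last K) = f 0 + ∑ k, r k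
  | 0, f, r, _ => by simp
  | K + 1, f, r, h => by
    rw [Fin.sum_univ_castSucc, ← add_assoc, ← Fin.succ_last, h (Fin.last K)]
    congr 1
    exact last_eq_add_sum (fun k => f k.castSucc) (fun k => r k.castSucc)
      fun k => h k.castSucc

lemma coe_sum_ereal {κ : Type*} (s : Finset κ) (f : κ → ℝ) :
    ((∑ k ∈ s, f k : ℝ) : EReal) = ∑ k ∈ s, (f k : EReal) := by
  classical
  induction s using Finset.induction_on with
  | empty => simp
  | insert k s hk ih => rw [Finset.sum_insert hk, Finset.sum_insert hk, EReal.coe_add, ih]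

variable {n : Type*} [Fintype n] [DecidableEq n]

lemma gaussianPdf_eq_zero_mean (m x : n → ℝ) (S : Matrix n n ℝ) :
    gaussianPdf m S x = gaussianPdf 0 S (x - m) := by
  simp [gaussianPdf]

lemma log_gaussianPdf_smul_one {s : ℝ} (hs : 0 < s) (m x : n → ℝ) :
    Real.log (gaussianPdf m (s • (1 : Matrix n n ℝ)) x) =
      ∑ i, (Real.log (√(2 * Real.pi * s))⁻¹ - (x i - m i) ^ 2 / (2 * s)) := by
  rw [gaussianPdf_smul_one hs, Real.log_prod fun i _ => by positivity]
  refine Finset.sum_congr rfl fun i _ => ?_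
  rw [Real.log_mul (by positivity) (Real.exp_pos _).ne', Real.log_exp]
  field_simp
  ring

/-- The second moments of a Gaussian vector about an arbitrary point. -/
lemma integral_sub_sq_multivariateGaussian {D : Matrix n n ℝ} (hD : D.PosSemidef)
    (a : EuclideanSpace ℝ n) (c : ℝ) (i : n) :
    Integrable (fun f : EuclideanSpace ℝ n => (c - f i) ^ 2) (multivariateGaussian a D) ∧
      ∫ f, (c - f i) ^ 2 ∂(multivariateGaussian a D) = (c - a i) ^ 2 + D i i := by
  have hid : MemLp id 2 (multivariateGaussian a D) := IsGaussian.memLp_two_id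
  have hi : MemLp (fun f : EuclideanSpace ℝ n => f i) 2 (multivariateGaussian a D) :=
    (EuclideanSpace.proj (𝕜 := ℝ) i).comp_memLp' hid
  have hci : MemLp (fun f : EuclideanSpace ℝ n => f i - c) 2 (multivariateGaussian a D) :=
    hi.sub (memLp_const c)
  have hmean : ∫ f, f i ∂(multivariateGaussian a D) = a i := by
    have := (EuclideanSpace.proj (𝕜 := ℝ) i).integral_comp_id_comm
      (IsGaussian.integrable_id (μ := multivariateGaussian a D))
    simpa using this
  have hvar := variance_eq_sub hci
  rw [variance_sub_const hi.1, variance_eval_multivariateGaussian hD,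
    integral_sub (hi.integrable (by norm_num)) (integrable_const c), hmean] at hvar
  simp only [integral_const, probReal_univ, one_smul, Pi.pow_apply] at hvar
  have hsq : ∀ f : EuclideanSpace ℝ n, (c - f i) ^ 2 = (f i - c) ^ 2 := fun f => by ring
  simp_rw [hsq]
  refine ⟨hci.integrable_sq, ?_⟩
  linear_combination -hvar

lemma UpperIntegrable.comp_fst {α β : Type*} [MeasurableSpace α] [MeasurableSpace β]
    {P : Measure α} [SFinite P] {κ : Kernel α β} [IsMarkovKernel κ] {f : α → ℝ}
    (hf : UpperIntegrable f P) (hm : Measurable f) :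
    UpperIntegrable (fun z => f z.1) (P ⊗ₘ κ) := by
  refine ⟨(hm.comp measurable_fst).aestronglyMeasurable, ?_⟩
  rw [Measure.lintegral_compProd (f := fun z : α × β => ENNReal.ofReal (f z.1)) (by fun_prop)]
  simpa using hf.2

lemma isDensity_gaussianPdf {M : ℕ} {S : Matrix (Fin M) (Fin M) ℝ} (hS : S.PosDef)
    (m : Fin M → ℝ) : IsDensity fun u => ENNReal.ofReal (gaussianPdf m S u) :=
  ⟨by fun_prop, lintegral_gaussianPdf hS m⟩

end Auxiliary

namespace Model

variable {𝒳 : Type*} {M K B : ℕ} {m : Model 𝒳 M K B}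

/-! ### Covariance matrices of the model -/

section Covariances

lemma gram_transpose (hk : (Matrix.of m.kernel).PosSemidef) {ι κ : Type*} (A : ι → 𝒳)
    (A' : κ → 𝒳) : (m.gram A A')ᵀ = m.gram A' A := by
  ext i j
  simpa [gram] using hk.isHermitian.apply (A' i) (A j)

lemma KRR_posDef (hk : (Matrix.of m.kernel).PosSemidef) (hR : IsUnit m.KRR) : m.KRR.PosDef := by
  have : m.KRR.PosSemidef := hk.submatrix m.R
  exact this.posDef_iff_isUnit.2 hR

/-- The conditional covariance is a Schur complement in a Gram matrix. -/
lemma D_posSemidef (hk : (Matrix.of m.kernel).PosSemidef) (hR : IsUnit m.KRR) {ι : Type*}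
    [Fintype ι] (A : ι → 𝒳) : (m.D A).PosSemidef := by
  have hP := KRR_posDef hk hR
  have := hR.invertible
  have h := hk.submatrix (Sum.elim m.R A)
  have hb : (Matrix.of m.kernel).submatrix (Sum.elim m.R A) (Sum.elim m.R A) =
      Matrix.fromBlocks m.KRR (m.gram m.R A) (m.gram m.R A)ᴴ (m.gram A A) := by
    rw [Matrix.conjTranspose_eq_transpose_of_trivial, gram_transpose hk]
    ext (i | i) (j | j) <;> rfl
  rw [hb, hP.fromBlocks₁₁, Matrix.conjTranspose_eq_transpose_of_trivial, gram_transpose hk] at h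
  exact h

/-- `H K_{RR} Hᵀ = Q` for the projection `H` at arbitrary inputs. -/
lemma H_mul_KRR_mul_transpose (hk : (Matrix.of m.kernel).PosSemidef) (hR : IsUnit m.KRR)
    {ι : Type*} (A : ι → 𝒳) :
    m.gram A m.R * m.KRR⁻¹ * m.KRR * (m.gram A m.R * m.KRR⁻¹)ᵀ = m.Q A := by
  have hu := (Matrix.isUnit_iff_isUnit_det _).1 hR
  have hT : m.KRRᵀ = m.KRR := gram_transpose hk _ _
  rw [Matrix.nonsing_inv_mul_cancel_right _ _ hu, Matrix.transpose_mul, gram_transpose hk,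
    Matrix.transpose_nonsing_inv, hT, Q, Matrix.mul_assoc]

lemma trace_D_XAll : (m.D m.XAll).trace = ∑ k, (m.D (m.X k)).trace := by
  simp only [Matrix.trace, Fintype.sum_prod_type]
  rfl

lemma qStar_zero : m.qStar 0 = m.prior := rfl

lemma cov_succ (k : Fin K) :
    m.cov k.succ = (postPrec (m.σ ^ 2) (m.H k) (m.cov k.castSucc))⁻¹ := by
  simp [cov, params, update, postPrec]

lemma mean_succ (k : Fin K) :
    m.mean k.succ = (postPrec (m.σ ^ 2) (m.H k) (m.cov k.castSucc))⁻¹ *ᵥ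
      ((m.σ ^ 2)⁻¹ • ((m.H k)ᵀ *ᵥ m.y k) + (m.cov k.castSucc)⁻¹ *ᵥ m.mean k.castSucc) := by
  simp [mean, cov, params, update, postPrec]

lemma innovCov_eq (k : Fin K) :
    m.innovCov k = predCov (m.σ ^ 2) (m.H k) (m.cov k.castSucc) := rfl

end Covariances

/-- The `k`-th summand of the recursive collapsed bound. -/
def recTerm (m : Model 𝒳 M K B) (k : Fin K) : ℝ :=
  Real.log (gaussianPdf (m.H k *ᵥ m.mean k.castSucc) (m.innovCov k) (m.y k)) -
    (m.D (m.X k)).trace / (2 * m.σ ^ 2)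

/-- The expected log-likelihood `∫ p(f_k | u) log p(y_k | f_k) df_k`, in closed form. -/
def expLogLik (m : Model 𝒳 M K B) (k : Fin K) (u : Fin M → ℝ) : ℝ :=
  Real.log (gaussianPdf (m.H k *ᵥ u) (m.noise (Fin B)) (m.y k)) -
    (m.D (m.X k)).trace / (2 * m.σ ^ 2)

lemma noise_posDef (hσ : 0 < m.σ) (ι : Type*) [Fintype ι] [DecidableEq ι] :
    (m.noise ι).PosDef :=
  Matrix.PosDef.one.smul (by positivity)

/-! ### The Gaussian recursion -/

section Gaussian

variable (hk : (Matrix.of m.kernel).PosSemidef) (hR : IsUnit m.KRR) (hσ : 0 < m.σ)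
include hk hR hσ

lemma cov_posDef (k : Fin (K + 1)) : (m.cov k).PosDef := by
  induction k using Fin.induction with
  | zero => exact KRR_posDef hk hR
  | succ k ih =>
    rw [cov_succ]
    exact (postPrec_posDef (by positivity) ih).inv

lemma innovCov_posDef (k : Fin K) : (m.innovCov k).PosDef :=
  predCov_posDef (by positivity) (cov_posDef hk hR hσ _)

lemma isDensity_qStar (k : Fin (K + 1)) : IsDensity (m.qStar k) :=
  isDensity_gaussianPdf (cov_posDef hk hR hσ k) _

lemma qStar_ne_zero (k : Fin (K + 1)) (u : Fin M → ℝ) : m.qStar k u ≠ 0 := by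
  simpa [qStar] using gaussianPdf_pos (cov_posDef hk hR hσ k) (m.mean k) u

lemma isDensity_prior : IsDensity m.prior :=
  qStar_zero (m := m) ▸ isDensity_qStar hk hR hσ 0

lemma bayes_update (k : Fin K) (u : Fin M → ℝ) :
    gaussianPdf (m.H k *ᵥ u) (m.noise (Fin B)) (m.y k) *
        gaussianPdf (m.mean k.castSucc) (m.cov k.castSucc) u =
      gaussianPdf (m.H k *ᵥ m.mean k.castSucc) (m.innovCov k) (m.y k) *
        gaussianPdf (m.mean k.succ) (m.cov k.succ) u := by
  rw [mean_succ, cov_succ, innovCov_eq]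
  exact gaussianPdf_mul_gaussianPdf (by positivity) (cov_posDef hk hR hσ _) _ _ _ _

lemma kalman_mean (k : Fin K) :
    m.mean k.succ = m.mean k.castSucc + m.gain k *ᵥ m.resid k := by
  rw [mean_succ]
  exact postMean_eq (by positivity) (cov_posDef hk hR hσ _) _ _

lemma kalman_cov (k : Fin K) :
    m.cov k.succ = m.cov k.castSucc - m.gain k * m.innovCov k * (m.gain k)ᵀ := by
  rw [cov_succ]
  exact postPrec_inv_eq (by positivity) (cov_posDef hk hR hσ _)

/-- Bayes' rule in logarithmic form, with the trace term subtracted from both sides. -/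
lemma log_bayes_update (k : Fin K) (u : Fin M → ℝ) :
    m.expLogLik k u + Real.log (m.qStar k.castSucc u).toReal =
      m.recTerm k + Real.log (m.qStar k.succ u).toReal := by
  have h1 := gaussianPdf_pos (cov_posDef hk hR hσ k.castSucc) (m.mean k.castSucc) u
  have h2 := gaussianPdf_pos (cov_posDef hk hR hσ k.succ) (m.mean k.succ) u
  have h3 := gaussianPdf_pos (noise_posDef hσ (Fin B)) (m.H k *ᵥ u) (m.y k)
  have h4 := gaussianPdf_pos (innovCov_posDef hk hR hσ k) (m.H k *ᵥ m.mean k.castSucc) (m.y k)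
  have h := congrArg Real.log (bayes_update hk hR hσ k u)
  rw [Real.log_mul h3.ne' h1.ne', Real.log_mul h4.ne' h2.ne'] at h
  rw [qStar, qStar, ENNReal.toReal_ofReal h1.le, ENNReal.toReal_ofReal h2.le, expLogLik, recTerm]
  linarith

/-- The sum of all updates: up to the constant `LREC`, the final Gaussian is the prior weighted with
the exponentials of all expected log-likelihoods. -/
lemma sum_log_bayes_update (u : Fin M → ℝ) :
    ∑ k, m.expLogLik k u + Real.log (m.prior u).toReal =
      m.LREC + Real.log (m.qStar (Fin.last K) u).toReal := by
  have h := last_eq_add_sum (fun k => Real.log (m.qStar k u).toReal)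
    (fun k => m.expLogLik k u - m.recTerm k) fun k => by
      have := log_bayes_update hk hR hσ k u
      linarith
  rw [Finset.sum_sub_distrib] at h
  have : m.LREC = ∑ k, m.recTerm k := rfl
  simp only [qStar_zero] at h
  linarith

/-- The recursive and the batch evidence agree: both are the normalizing constant of the product of
all likelihoods `N(y_k; H_k u, σ² I)` with the prior. -/
lemma LREC_eq_LVFE : m.LREC = m.LVFE := by
  set HA : Matrix (Fin K × Fin B) (Fin M) ℝ := m.gram m.XAll m.R * m.KRR⁻¹ with hHA
  set L := (postPrec (m.σ ^ 2) HA m.KRR)⁻¹ with hL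
  set ν := L *ᵥ ((m.σ ^ 2)⁻¹ • (HAᵀ *ᵥ m.yAll) + m.KRR⁻¹ *ᵥ 0) with hν
  have hs : 0 < m.σ ^ 2 := by positivity
  have hP := KRR_posDef hk hR
  have hLpos : L.PosDef := (postPrec_posDef hs hP).inv
  have hcov : predCov (m.σ ^ 2) HA m.KRR = m.Q m.XAll + m.noise (Fin K × Fin B) := by
    rw [predCov, hHA, H_mul_KRR_mul_transpose hk hR]
    rfl
  have hcovpos := predCov_posDef (H := HA) hs hP
  set T := (m.D m.XAll).trace / (2 * m.σ ^ 2) with hT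
  -- the likelihood of the stacked data factorizes over the mini-batches
  have hlik : ∀ u, Real.log (gaussianPdf (HA *ᵥ u) (m.σ ^ 2 • 1) m.yAll) =
      ∑ k, m.expLogLik k u + T := by
    intro u
    rw [hT, trace_D_XAll, Finset.sum_div, ← Finset.sum_add_distrib, log_gaussianPdf_smul_one hs,
      Fintype.sum_prod_type]
    refine Finset.sum_congr rfl fun k _ => ?_
    rw [expLogLik, sub_add_cancel, noise, log_gaussianPdf_smul_one hs]
    rfl
  have hlog : ∀ u, Real.log (m.qStar (Fin.last K) u).toReal =
      (m.LVFE - m.LREC) + Real.log (gaussianPdf ν L u) := by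
    intro u
    have h := congrArg Real.log (gaussianPdf_mul_gaussianPdf hs hP HA m.yAll 0 u)
    rw [Real.log_mul (gaussianPdf_pos (Matrix.PosDef.one.smul hs) _ _).ne'
      (gaussianPdf_pos hP _ _).ne', Real.log_mul (gaussianPdf_pos hcovpos _ _).ne'
      (gaussianPdf_pos hLpos _ _).ne', hcov, hlik, Matrix.mulVec_zero] at h
    have h' := sum_log_bayes_update hk hR hσ u
    rw [prior, ENNReal.toReal_ofReal (gaussianPdf_pos hP _ _).le] at h'
    have hV : m.LVFE =
        Real.log (gaussianPdf 0 (m.Q m.XAll + m.noise (Fin K × Fin B)) m.yAll) - T := rfl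
    linarith
  have hmul : ∀ u, m.qStar (Fin.last K) u =
      ENNReal.ofReal (Real.exp (m.LVFE - m.LREC)) * ENNReal.ofReal (gaussianPdf ν L u) := by
    intro u
    have hq := gaussianPdf_pos (cov_posDef hk hR hσ (Fin.last K)) (m.mean (Fin.last K)) u
    have h := hlog u
    rw [qStar, ENNReal.toReal_ofReal hq.le] at h
    rw [qStar, ← ENNReal.ofReal_mul (Real.exp_pos _).le, ← Real.exp_log hq, h, Real.exp_add,
      Real.exp_log (gaussianPdf_pos hLpos _ _)]
  -- proportional normalized densities have ratio one
  have hint : ∫⁻ u, m.qStar (Fin.last K) u = 1 := (isDensity_qStar hk hR hσ _).2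
  simp_rw [hmul] at hint
  rw [lintegral_const_mul _ (by fun_prop), lintegral_gaussianPdf hLpos, mul_one,
    ENNReal.ofReal_eq_one, Real.exp_eq_one_iff] at hint
  linarith

end Gaussian

lemma LREC_eq_innovation : m.LREC = ∑ k : Fin K,
    (Real.log (gaussianPdf 0 (m.innovCov k) (m.resid k)) -
      (m.D (m.X k)).trace / (2 * m.σ ^ 2)) := by
  refine Finset.sum_congr rfl fun k _ => ?_
  rw [gaussianPdf_eq_zero_mean]
  rfl

/-! ### Measurability, and the terms of the bound -/

@[fun_prop]
lemma continuous_lik (k : Fin K) : Continuous (m.lik k) := by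
  unfold lik
  fun_prop

lemma measurable_log_lik (k : Fin K) : Measurable fun f => Real.log (m.lik k f) :=
  Real.measurable_log.comp (continuous_lik k).measurable

lemma measurable_condLik (k : Fin K) : Measurable (m.condLik k) :=
  Measurable.lintegral_kernel (continuous_lik k).measurable.ennreal_ofReal

lemma measurable_unnormPosterior (k : Fin (K + 1)) : Measurable (m.unnormPosterior k) := by
  refine Measurable.mul (Finset.measurable_prod _ fun j _ => ?_) ?_
  · split_ifs
    · exact measurable_condLik j
    · exact measurable_const
  · exact (continuous_gaussianPdf _ _).measurable.ennreal_ofReal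

lemma measurable_exactPosterior (k : Fin (K + 1)) : Measurable (m.exactPosterior k) :=
  (measurable_unnormPosterior k).div_const _

lemma measurable_expLogLik (k : Fin K) : Measurable (m.expLogLik k) := by
  have h : Continuous fun u => gaussianPdf (m.H k *ᵥ u) (m.noise (Fin B)) (m.y k) :=
    (continuous_gaussianPdf_mean _ _).comp (by fun_prop)
  exact (Real.measurable_log.comp h.measurable).sub_const _

lemma unnormPosterior_zero (u : Fin M → ℝ) : m.unnormPosterior 0 u = m.prior u := by
  simp [unnormPosterior]

lemma unnormPosterior_succ (k : Fin K) (u : Fin M → ℝ) :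
    m.unnormPosterior k.succ u = m.condLik k u * m.unnormPosterior k.castSucc u := by
  have h : ∀ j : Fin K, (if j.castSucc < k.succ then m.condLik j u else 1) =
      (if k = j then m.condLik j u else 1) *
        (if j.castSucc < k.castSucc then m.condLik j u else 1) := by
    intro j
    rcases lt_trichotomy j k with h | h | h
    · have h1 : j.castSucc < k.succ := Fin.castSucc_lt_succ_iff.2 h.le
      simp [h, h.ne', h1]
    · subst h
      simp
    · have h1 : ¬ j.castSucc < k.succ := fun h' => absurd (Fin.castSucc_lt_succ_iff.1 h') h.not_ge
      simp [h.ne, h1, h.not_gt]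
  simp only [unnormPosterior]
  rw [Finset.prod_congr rfl fun j _ => h j, Finset.prod_mul_distrib, Finset.prod_ite_eq]
  simp [mul_assoc]

lemma unnormPosterior_last (u : Fin M → ℝ) :
    m.unnormPosterior (Fin.last K) u = (∏ k, m.condLik k u) * m.prior u := by
  simp [unnormPosterior, Fin.castSucc_lt_last]

lemma lintegral_joint (k : Fin K) (q : (Fin M → ℝ) → ℝ≥0∞) [SFinite (volume.withDensity q)]
    {f : (Fin M → ℝ) × EuclideanSpace ℝ (Fin B) → ℝ≥0∞} (hf : Measurable f) :
    ∫⁻ z, f z ∂m.joint k q = ∫⁻ u, ∫⁻ x, f (u, x) ∂m.latent k u ∂volume.withDensity q :=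
  Measure.lintegral_compProd hf

lemma ae_joint_of_ae {k : Fin K} {q : (Fin M → ℝ) → ℝ≥0∞} [SFinite (volume.withDensity q)]
    {p : (Fin M → ℝ) → Prop} (h : ∀ᵐ u ∂volume.withDensity q, p u) :
    ∀ᵐ z ∂m.joint k q, p z.1 := by
  have : (volume.withDensity q) = (m.joint k q).map Prod.fst :=
    (Measure.fst_compProd _ _).symm
  rw [this] at h
  exact ae_of_ae_map measurable_fst.aemeasurable h

/-- A summand of the bound depends only on the laws, not on the chosen densities. -/
lemma term_congr_ae {k : Fin K} {q' r' q r : (Fin M → ℝ) → ℝ≥0∞} (hq : IsDensity q)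
    (h' : q' =ᵐ[volume] r') (h : q =ᵐ[volume] r) : m.term k q' q = m.term k r' r := by
  have := hq.isProbabilityMeasure
  have hj : m.joint k q = m.joint k r := by
    rw [joint, joint, withDensity_congr_ae h]
  rw [term, term, ← hj]
  refine extIntegral_congr_ae ?_
  have hqv : volume.withDensity q ≪ volume := withDensity_absolutelyContinuous _ _
  filter_upwards [ae_joint_of_ae (hqv.ae_le h), ae_joint_of_ae (hqv.ae_le h')] with z h1 h2
  rw [h1, h2]

/-- Jensen's inequality for one summand of the bound. -/
lemma term_le_log_lintegral {k : Fin K} {q' q : (Fin M → ℝ) → ℝ≥0∞} (hq : IsDensity q)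
    (hq' : Measurable q') :
    m.term k q' q ≤ ENNReal.log (∫⁻ u, m.condLik k u * q' u) := by
  have := hq.isProbabilityMeasure
  have : IsProbabilityMeasure (m.joint k q) := by unfold joint; infer_instance
  have hlik : Measurable fun f => ENNReal.ofReal (m.lik k f) :=
    (continuous_lik k).measurable.ennreal_ofReal
  have hw : Measurable fun z : (Fin M → ℝ) × EuclideanSpace ℝ (Fin B) =>
      ENNReal.ofReal (m.lik k z.2) * q' z.1 / q z.1 :=
    ((hlik.comp measurable_snd).mul (hq'.comp measurable_fst)).div (hq.1.comp measurable_fst)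
  refine (extIntegral_log_le hw).trans (ENNReal.log_monotone ?_)
  rw [lintegral_joint k q hw]
  refine le_trans (le_of_eq (lintegral_congr fun u => ?_))
    (lintegral_div_withDensity_le hq.1 ((measurable_condLik k).mul hq'))
  simp only [mul_div_assoc]
  rw [lintegral_mul_const _ hlik]
  simp [condLik]

/-! ### Integrating out the latent function values -/

section Latent

variable (hk : (Matrix.of m.kernel).PosSemidef) (hR : IsUnit m.KRR) (hσ : 0 < m.σ)
include hσ

lemma lik_pos (k : Fin K) (f : EuclideanSpace ℝ (Fin B)) : 0 < m.lik k f :=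
  gaussianPdf_pos (noise_posDef hσ _) _ _

/-- The likelihood is bounded, uniformly over the mini-batches. -/
lemma exists_lik_le : ∃ C : ℝ, 0 < C ∧ ∀ (k : Fin K) f, m.lik k f ≤ C := by
  have := (noise_posDef hσ (Fin B)).det_pos
  exact ⟨_, by positivity, fun k f => gaussianPdf_le (noise_posDef hσ (Fin B)) _ _⟩

include hk hR

/-- The squared error has conditional mean `‖y_k - H_k u‖² + tr D`, which accounts for the trace
term. -/
lemma log_lik_latent (k : Fin K) (u : Fin M → ℝ) :
    Integrable (fun f => Real.log (m.lik k f)) (m.latent k u) ∧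
      ∫ f, Real.log (m.lik k f) ∂m.latent k u = m.expLogLik k u := by
  have hs : 0 < m.σ ^ 2 := by positivity
  have hlat : m.latent k u =
    multivariateGaussian (WithLp.toLp 2 (m.H k *ᵥ u)) (m.D (m.X k)) := rfl
  have hmom := integral_sub_sq_multivariateGaussian (D_posSemidef hk hR (m.X k))
    (WithLp.toLp 2 (m.H k *ᵥ u))
  have hlog : ∀ f, Real.log (m.lik k f) =
      ∑ i, (Real.log (√(2 * Real.pi * m.σ ^ 2))⁻¹ - (m.y k i - f i) ^ 2 / (2 * m.σ ^ 2)) :=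
    fun f => log_gaussianPdf_smul_one hs _ _
  simp_rw [hlog, hlat]
  have hi : ∀ i ∈ Finset.univ, Integrable (fun f : EuclideanSpace ℝ (Fin B) =>
      Real.log (√(2 * Real.pi * m.σ ^ 2))⁻¹ - (m.y k i - f i) ^ 2 / (2 * m.σ ^ 2))
      (multivariateGaussian (WithLp.toLp 2 (m.H k *ᵥ u)) (m.D (m.X k))) :=
    fun i _ => (integrable_const _).sub ((hmom _ i).1.div_const _)
  refine ⟨integrable_finsetSum _ hi, ?_⟩
  rw [integral_finsetSum _ hi, expLogLik, noise, log_gaussianPdf_smul_one hs, Matrix.trace,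
    Finset.sum_div, ← Finset.sum_sub_distrib]
  refine Finset.sum_congr rfl fun i _ => ?_
  rw [integral_sub (integrable_const _) ((hmom _ i).1.div_const _), integral_div, (hmom _ i).2]
  simp
  ring

/-- Jensen's inequality within a mini-batch. -/
lemma exp_expLogLik_le_condLik (k : Fin K) (u : Fin M → ℝ) :
    ENNReal.ofReal (Real.exp (m.expLogLik k u)) ≤ m.condLik k u := by
  obtain ⟨C, hC, hle⟩ := exists_lik_le hσ (m := m)
  have hint : Integrable (fun f => m.lik k f) (m.latent k u) := by
    refine Integrable.of_bound (continuous_lik k).aestronglyMeasurable C (.of_forall fun f => ?_)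
    rw [Real.norm_of_nonneg (lik_pos hσ k f).le]
    exact hle k f
  have hexp : ∀ f, Real.exp (Real.log (m.lik k f)) = m.lik k f :=
    fun f => Real.exp_log (lik_pos hσ k f)
  have h := log_lik_latent hk hR hσ k u
  have hj := convexOn_exp.map_integral_le (μ := m.latent k u)
    (f := fun f => Real.log (m.lik k f)) Real.continuous_exp.continuousOn isClosed_univ
    (by simp) h.1 (by simpa [Function.comp_def, hexp] using hint)
  rw [h.2] at hj
  simp_rw [hexp] at hj
  rw [condLik, ← ofReal_integral_eq_lintegral_ofReal hint (.of_forall fun f => (lik_pos hσ k f).le)]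
  exact ENNReal.ofReal_le_ofReal hj

lemma condLik_ne_zero (k : Fin K) (u : Fin M → ℝ) : m.condLik k u ≠ 0 :=
  ((ENNReal.ofReal_pos.2 (Real.exp_pos _)).trans_le (exp_expLogLik_le_condLik hk hR hσ k u)).ne'

lemma unnormPosterior_ne_zero (k : Fin (K + 1)) (u : Fin M → ℝ) : m.unnormPosterior k u ≠ 0 := by
  induction k using Fin.induction with
  | zero => rw [unnormPosterior_zero]; exact qStar_ne_zero hk hR hσ 0 u
  | succ k ih => rw [unnormPosterior_succ]; exact mul_ne_zero (condLik_ne_zero hk hR hσ k u) ih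

end Latent

/-! ### The exact evidence -/

section Evidence

variable (hk : (Matrix.of m.kernel).PosSemidef) (hR : IsUnit m.KRR) (hσ : 0 < m.σ)
include hk hR hσ

lemma evidence_zero : m.evidence 0 = 1 := by
  simp only [evidence, unnormPosterior_zero]
  exact (isDensity_prior hk hR hσ).2

/-- The evidence is positive and, with `evidence_ne_top`, finite, so that the quotient defining the
exact posterior is a genuine one. -/
lemma evidence_ne_zero (k : Fin (K + 1)) : m.evidence k ≠ 0 := by
  intro h
  rw [evidence, lintegral_eq_zero_iff (measurable_unnormPosterior k)] at h
  have : ∀ᵐ _u : Fin M → ℝ, False := by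
    filter_upwards [h] with u hu using unnormPosterior_ne_zero hk hR hσ k u hu
  exact NeZero.ne (volume : Measure (Fin M → ℝ)) (by simpa using this)

lemma evidence_ne_top (k : Fin (K + 1)) : m.evidence k ≠ ∞ := by
  induction k using Fin.induction with
  | zero => simp [evidence_zero hk hR hσ]
  | succ k ih =>
    obtain ⟨C, hC, hle⟩ := exists_lik_le hσ (m := m)
    have hcond : ∀ u, m.condLik k u ≤ ENNReal.ofReal C := fun u =>
      (lintegral_mono fun f => ENNReal.ofReal_le_ofReal (hle k f)).trans (by simp)
    simp only [evidence, unnormPosterior_succ]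
    refine ne_top_of_le_ne_top (ENNReal.mul_ne_top (ENNReal.ofReal_ne_top (r := C)) ih) ?_
    rw [evidence, ← lintegral_const_mul _ (measurable_unnormPosterior _)]
    exact lintegral_mono fun u => mul_le_mul_left (hcond u) _

lemma evidence_succ (k : Fin K) : m.evidence k.succ =
    m.evidence k.castSucc * ∫⁻ u, m.condLik k u * m.exactPosterior k.castSucc u := by
  have hm : Measurable fun u => m.condLik k u * m.exactPosterior k.castSucc u :=
    (measurable_condLik k).mul (measurable_exactPosterior _)
  rw [← lintegral_const_mul _ hm, evidence]
  refine lintegral_congr fun u => ?_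
  rw [unnormPosterior_succ, mul_left_comm, exactPosterior,
    ENNReal.mul_div_cancel (evidence_ne_zero hk hR hσ _) (evidence_ne_top hk hR hσ _)]

/-- The chain rule `log p(y) = ∑ log p(y_k | y_{1:k-1})`. -/
lemma log_evidence_last : ENNReal.log (m.evidence (Fin.last K)) =
    ∑ k : Fin K, ENNReal.log (∫⁻ u, m.condLik k u * m.exactPosterior k.castSucc u) := by
  have h := last_eq_add_sum (fun k => ENNReal.log (m.evidence k))
    (fun k => ENNReal.log (∫⁻ u, m.condLik k u * m.exactPosterior k.castSucc u)) fun k => by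
      rw [evidence_succ hk hR hσ, ENNReal.log_mul_add]
  rwa [evidence_zero hk hR hσ, ENNReal.log_one, zero_add] at h

lemma sum_term_le_log_evidence (q : Fin K → (Fin M → ℝ) → ℝ≥0∞) (hq : ∀ k, IsDensity (q k)) :
    ∑ k : Fin K, m.term k (m.exactPosterior k.castSucc) (q k) ≤
      ENNReal.log (m.evidence (Fin.last K)) := by
  rw [log_evidence_last hk hR hσ]
  exact Finset.sum_le_sum fun k _ => term_le_log_lintegral (hq k) (measurable_exactPosterior _)

lemma LREC_le_log_evidence : ((m.LREC : ℝ) : EReal) ≤ ENNReal.log (m.evidence (Fin.last K)) := by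
  have hexp : ENNReal.ofReal (Real.exp m.LREC) ≤ m.evidence (Fin.last K) := by
    have hq := isDensity_qStar hk hR hσ (Fin.last K)
    calc ENNReal.ofReal (Real.exp m.LREC)
        = ∫⁻ u, ENNReal.ofReal (Real.exp m.LREC) * m.qStar (Fin.last K) u := by
          rw [lintegral_const_mul _ hq.1, hq.2, mul_one]
      _ ≤ m.evidence (Fin.last K) := lintegral_mono fun u => ?_
    rw [unnormPosterior_last]
    have h1 := gaussianPdf_pos (cov_posDef hk hR hσ (Fin.last K)) (m.mean (Fin.last K)) u
    have h0 := gaussianPdf_pos (KRR_posDef hk hR) 0 u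
    have h := sum_log_bayes_update hk hR hσ u
    rw [qStar, prior, ENNReal.toReal_ofReal h1.le, ENNReal.toReal_ofReal h0.le] at h
    calc ENNReal.ofReal (Real.exp m.LREC) * m.qStar (Fin.last K) u
        = ENNReal.ofReal (∏ k, Real.exp (m.expLogLik k u)) * m.prior u := by
          rw [qStar, prior, ← ENNReal.ofReal_mul (by positivity),
            ← ENNReal.ofReal_mul (by positivity), ← Real.exp_sum]
          nth_rw 1 [← Real.exp_log h1]
          nth_rw 1 [← Real.exp_log h0]
          rw [← Real.exp_add, ← Real.exp_add, h]
      _ ≤ (∏ k, m.condLik k u) * m.prior u := by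
          rw [ENNReal.ofReal_prod_of_nonneg fun k _ => (Real.exp_pos _).le]
          exact mul_le_mul_left (Finset.prod_le_prod' fun k _ =>
            exp_expLogLik_le_condLik hk hR hσ k u) _
  have := ENNReal.log_monotone hexp
  rwa [ENNReal.log_ofReal_of_pos (Real.exp_pos _), Real.log_exp] at this

end Evidence

/-! ### Maximization of the bounds -/

section Maximization

variable (hk : (Matrix.of m.kernel).PosSemidef) (hR : IsUnit m.KRR) (hσ : 0 < m.σ)
include hk hR hσ

/-- A summand of the bound falls short of its maximum by the Kullback–Leibler divergence from the
Gaussian Bayes update. -/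
lemma term_qStar_eq (k : Fin K) {q : (Fin M → ℝ) → ℝ≥0∞} (hq : IsDensity q) :
    m.term k (m.qStar k.castSucc) q = ((m.recTerm k : ℝ) : EReal) -
      ((InformationTheory.klDiv (volume.withDensity q) (volume.withDensity (m.qStar k.succ)) :
        ℝ≥0∞) : EReal) := by
  have := hq.isProbabilityMeasure
  have hq' := isDensity_qStar hk hR hσ k.castSucc
  have hq'0 := qStar_ne_zero hk hR hσ k.castSucc
  have hr := isDensity_qStar hk hR hσ k.succ
  have hr0 := qStar_ne_zero hk hR hσ k.succ
  obtain ⟨C, hC, hle⟩ := exists_lik_le hσ (m := m)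
  -- `φ` is the part of the integrand that does not involve `f_k`
  set φ : (Fin M → ℝ) → ℝ := fun u =>
    Real.log (m.qStar k.castSucc u).toReal - Real.log (q u).toReal with hφ
  have hφm : Measurable φ :=
    (Real.measurable_log.comp hq'.1.ennreal_toReal).sub
      (Real.measurable_log.comp hq.1.ennreal_toReal)
  have hφup : UpperIntegrable φ (volume.withDensity q) := by
    refine (upperIntegrable_neg_llr hq hq' hq'0).mono hφm.aestronglyMeasurable ?_
    filter_upwards [ae_withDensity_llr_eq hq hq' hq'0] with u hu
    rw [hu, hφ]
    simp
  set g : (Fin M → ℝ) × EuclideanSpace ℝ (Fin B) → ℝ := fun z =>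
    Real.log (m.lik k z.2) + φ z.1 with hg
  have hgm : Measurable g :=
    ((measurable_log_lik k).comp measurable_snd).add (hφm.comp measurable_fst)
  have hgup : UpperIntegrable g ((volume.withDensity q) ⊗ₘ (m.latent k)) := by
    refine ((integrable_const (Real.log C)).upperIntegrable.add (hφup.comp_fst hφm)).mono
      hgm.aestronglyMeasurable (.of_forall fun z => ?_)
    exact add_le_add_left (Real.log_le_log (lik_pos hσ k _) (hle k _)) _
  have hterm : m.term k (m.qStar k.castSucc) q =
      extIntegral ((volume.withDensity q) ⊗ₘ (m.latent k)) fun z => (g z : EReal) := by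
    refine extIntegral_congr_ae ?_
    filter_upwards [ae_joint_of_ae hq.ae_ne_zero, ae_joint_of_ae hq.ae_ne_top] with z h1 h2
    have hl := lik_pos hσ k z.2
    have hqp := ENNReal.toReal_pos h1 h2
    have hqs : 0 < (m.qStar k.castSucc z.1).toReal :=
      ENNReal.toReal_pos (hq'0 z.1) ENNReal.ofReal_ne_top
    rw [ENNReal.log_pos_real']
    · rw [ENNReal.toReal_div, ENNReal.toReal_mul, ENNReal.toReal_ofReal hl.le,
        Real.log_div (mul_pos hl hqs).ne' hqp.ne', Real.log_mul hl.ne' hqs.ne', hg, hφ]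
      simp only [add_sub_assoc]
    · rw [ENNReal.toReal_div, ENNReal.toReal_mul, ENNReal.toReal_ofReal hl.le]
      positivity
  rw [hterm, (extIntegral_compProd hgm hgup (h := fun u => m.expLogLik k u + φ u)
    ((measurable_expLogLik k).add hφm)
    (fun u => (log_lik_latent hk hR hσ k u).1.add (integrable_const (φ u))) fun u => ?_).2,
    ← extIntegral_const_sub_llr hq hr hr0]
  · refine extIntegral_congr_ae ?_
    filter_upwards [ae_withDensity_llr_eq hq hr hr0] with u hu
    have h := log_bayes_update hk hR hσ k u
    rw [hu, EReal.coe_eq_coe_iff, hφ]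
    linarith
  · simp only [hg]
    rw [integral_add (log_lik_latent hk hR hσ k u).1 (integrable_const _),
      (log_lik_latent hk hR hσ k u).2]
    simp

lemma term_qStar_qStar (k : Fin K) :
    m.term k (m.qStar k.castSucc) (m.qStar k.succ) = ((m.recTerm k : ℝ) : EReal) := by
  have := (isDensity_qStar hk hR hσ k.succ).isProbabilityMeasure
  rw [term_qStar_eq hk hR hσ k (isDensity_qStar hk hR hσ _), InformationTheory.klDiv_self]
  simp

lemma term_qStar_le (k : Fin K) {q : (Fin M → ℝ) → ℝ≥0∞} (hq : IsDensity q) :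
    m.term k (m.qStar k.castSucc) q ≤ ((m.recTerm k : ℝ) : EReal) := by
  rw [term_qStar_eq hk hR hσ k hq]
  simpa using EReal.sub_le_sub le_rfl (EReal.coe_ennreal_nonneg _)

/-- Uniqueness of the maximizer: attaining the optimal value forces zero divergence. -/
lemma ae_eq_qStar_of_le_term (k : Fin K) {q : (Fin M → ℝ) → ℝ≥0∞} (hq : IsDensity q)
    (h : ((m.recTerm k : ℝ) : EReal) ≤ m.term k (m.qStar k.castSucc) q) :
    q =ᵐ[volume] m.qStar k.succ := by
  have hr := isDensity_qStar hk hR hσ k.succ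
  have := hq.isProbabilityMeasure
  have := hr.isProbabilityMeasure
  rw [term_qStar_eq hk hR hσ k hq] at h
  set d := InformationTheory.klDiv (volume.withDensity q) (volume.withDensity (m.qStar k.succ))
    with hd
  have hd0 : d = 0 := by
    by_cases htop : d = ∞
    · rw [htop] at h
      simp at h
    · rw [← EReal.coe_ennreal_toReal htop, ← EReal.coe_sub, EReal.coe_le_coe_iff] at h
      have h0 : d.toReal = 0 := le_antisymm (by linarith) ENNReal.toReal_nonneg
      exact (ENNReal.toReal_eq_zero_iff d).1 h0 |>.resolve_right htop
  rw [hd, InformationTheory.klDiv_eq_zero_iff] at hd0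
  exact (withDensity_eq_iff hq.1.aemeasurable hr.1.aemeasurable (by simp [hq.2])).1 hd0

lemma isRecursiveMaximizer_qStar : m.IsRecursiveMaximizer m.qStar :=
  ⟨qStar_zero, fun k => ⟨isDensity_qStar hk hR hσ _, fun p hp => by
    rw [term_qStar_qStar hk hR hσ]
    exact term_qStar_le hk hR hσ k hp⟩⟩

lemma IsRecursiveMaximizer.ae_eq_qStar {q : Fin (K + 1) → (Fin M → ℝ) → ℝ≥0∞}
    (hq : m.IsRecursiveMaximizer q) (k : Fin (K + 1)) : q k =ᵐ[volume] m.qStar k := by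
  induction k using Fin.induction with
  | zero => rw [hq.1]; rfl
  | succ k ih =>
    have hs := isDensity_qStar hk hR hσ k.succ
    have hmax := (hq.2 k).2 _ hs
    rw [term_congr_ae hs ih (ae_eq_refl _), term_congr_ae (hq.2 k).1 ih (ae_eq_refl _),
      term_qStar_qStar hk hR hσ] at hmax
    exact ae_eq_qStar_of_le_term hk hR hσ k (hq.2 k).1 hmax

lemma IsRecursiveMaximizer.bound_eq {q : Fin (K + 1) → (Fin M → ℝ) → ℝ≥0∞}
    (hq : m.IsRecursiveMaximizer q) : m.bound q = ((m.LREC : ℝ) : EReal) := by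
  have h : m.LREC = ∑ k, m.recTerm k := rfl
  rw [bound, h, coe_sum_ereal]
  refine Finset.sum_congr rfl fun k _ => ?_
  rw [term_congr_ae (hq.2 k).1 (hq.ae_eq_qStar hk hR hσ _) (hq.ae_eq_qStar hk hR hσ _),
    term_qStar_qStar hk hR hσ]

/-- The uncollapsed bound falls short of the recursive collapsed bound by the Kullback–Leibler
divergence from the final Gaussian. -/
lemma LSVGP_eq (ν : Fin M → ℝ) {S : Matrix (Fin M) (Fin M) ℝ} (hS : S.PosDef) :
    m.LSVGP ν S = ((m.LREC : ℝ) : EReal) - ((InformationTheory.klDiv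
      (volume.withDensity fun u => ENNReal.ofReal (gaussianPdf ν S u))
      (volume.withDensity (m.qStar (Fin.last K))) : ℝ≥0∞) : EReal) := by
  have hq := isDensity_gaussianPdf hS ν
  set q : (Fin M → ℝ) → ℝ≥0∞ := fun u => ENNReal.ofReal (gaussianPdf ν S u) with hqdef
  have := hq.isProbabilityMeasure
  have hp := isDensity_prior hk hR hσ
  have hp0 : ∀ u, m.prior u ≠ 0 := qStar_ne_zero hk hR hσ 0
  have hr := isDensity_qStar hk hR hσ (Fin.last K)
  have hr0 := qStar_ne_zero hk hR hσ (Fin.last K)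
  obtain ⟨C, hC, hle⟩ := exists_lik_le hσ (m := m)
  -- the latent values integrate out of each expected log-likelihood
  have hfub : ∀ k : Fin K, UpperIntegrable (m.expLogLik k) (volume.withDensity q) ∧
      extIntegral (m.joint k q) (fun z => ((Real.log (m.lik k z.2) : ℝ) : EReal)) =
        extIntegral (volume.withDensity q) fun u => (m.expLogLik k u : EReal) := by
    intro k
    have hgm : Measurable fun z : (Fin M → ℝ) × EuclideanSpace ℝ (Fin B) =>
        Real.log (m.lik k z.2) := (measurable_log_lik k).comp measurable_snd
    refine extIntegral_compProd hgm ?_ (measurable_expLogLik k)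
      (fun u => (log_lik_latent hk hR hσ k u).1) fun u => (log_lik_latent hk hR hσ k u).2
    exact (integrable_const (Real.log C)).upperIntegrable.mono hgm.aestronglyMeasurable
      (.of_forall fun z => Real.log_le_log (lik_pos hσ k _) (hle k _))
  have hsum : ∑ k : Fin K, extIntegral (m.joint k q)
      (fun z => ((Real.log (m.lik k z.2) : ℝ) : EReal)) =
      extIntegral (volume.withDensity q) fun u => ((∑ k, m.expLogLik k u : ℝ) : EReal) := by
    rw [extIntegral_sum _ fun k => (hfub k).1]
    exact Finset.sum_congr rfl fun k _ => (hfub k).2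
  rw [LSVGP, ← hqdef, hsum, ← extIntegral_neg_llr hq hp hp0,
    ← extIntegral_add (upperIntegrable_neg_llr hq hp hp0)
      (UpperIntegrable.sum _ fun k => (hfub k).1), ← extIntegral_const_sub_llr hq hr hr0]
  refine extIntegral_congr_ae ?_
  filter_upwards [ae_withDensity_llr_eq hq hr hr0, ae_withDensity_llr_eq hq hp hp0] with u h1 h2
  have h := sum_log_bayes_update hk hR hσ u
  rw [h1, h2, EReal.coe_eq_coe_iff]
  linarith

lemma LSVGP_le (ν : Fin M → ℝ) {S : Matrix (Fin M) (Fin M) ℝ} (hS : S.PosDef) :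
    m.LSVGP ν S ≤ ((m.LREC : ℝ) : EReal) := by
  rw [LSVGP_eq hk hR hσ ν hS]
  simpa using EReal.sub_le_sub le_rfl (EReal.coe_ennreal_nonneg _)

lemma LSVGP_optimum :
    m.LSVGP (m.mean (Fin.last K)) (m.cov (Fin.last K)) = ((m.LREC : ℝ) : EReal) := by
  have := (isDensity_qStar hk hR hσ (Fin.last K)).isProbabilityMeasure
  rw [LSVGP_eq hk hR hσ _ (cov_posDef hk hR hσ _),
    show (fun u => ENNReal.ofReal (gaussianPdf (m.mean (Fin.last K)) (m.cov (Fin.last K)) u)) =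
      m.qStar (Fin.last K) from rfl, InformationTheory.klDiv_self]
  simp

end Maximization

end Model

end SparseGP

end

theorem mainTheorem2 {𝒳 : Type*} {M K B : ℕ} (m : SparseGP.Model 𝒳 M K B)
    (hkernel : (Matrix.of m.kernel).PosSemidef)
    (hR : IsUnit m.KRR) (hσ : 0 < m.σ) :
    -- the exact evidence factorizes, and the Jensen-type sum bounds it from below
    (ENNReal.log (m.evidence (Fin.last K)) =
        ∑ k : Fin K, ENNReal.log (∫⁻ u, m.condLik k u * m.exactPosterior k.castSucc u) ∧
      ∀ q : Fin K → (Fin M → ℝ) → ENNReal, (∀ k, SparseGP.IsDensity (q k)) →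
        ∑ k : Fin K, m.term k (m.exactPosterior k.castSucc) (q k) ≤
          ENNReal.log (m.evidence (Fin.last K))) ∧
    -- the recursive maximizer is the Gaussian sequence, uniquely, with optimal value `LREC`
    (m.IsRecursiveMaximizer m.qStar ∧
      ∀ q, m.IsRecursiveMaximizer q →
        (∀ k, q k =ᵐ[MeasureTheory.volume] m.qStar k) ∧ m.bound q = ((m.LREC : ℝ) : EReal)) ∧
    -- all covariances are positive definite
    (∀ k, (m.cov k).PosDef) ∧
    -- recursive Bayesian update
    (∀ (k : Fin K) (u : Fin M → ℝ),
      SparseGP.gaussianPdf (m.H k *ᵥ u) (m.noise (Fin B)) (m.y k) *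
          SparseGP.gaussianPdf (m.mean k.castSucc) (m.cov k.castSucc) u =
        SparseGP.gaussianPdf (m.H k *ᵥ m.mean k.castSucc) (m.innovCov k) (m.y k) *
          SparseGP.gaussianPdf (m.mean k.succ) (m.cov k.succ) u) ∧
    -- Kalman filter update
    (∀ k : Fin K,
      m.mean k.succ = m.mean k.castSucc + m.gain k *ᵥ m.resid k ∧
      m.cov k.succ = m.cov k.castSucc - m.gain k * m.innovCov k * (m.gain k)ᵀ) ∧
    -- the innovation form of the recursive collapsed bound
    m.LREC = ∑ k : Fin K, (Real.log (SparseGP.gaussianPdf 0 (m.innovCov k) (m.resid k)) -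
      (m.D (m.X k)).trace / (2 * m.σ ^ 2)) ∧
    -- the recursive collapsed bound equals the batch collapsed bound, and is a lower bound
    m.LREC = m.LVFE ∧
    ((m.LREC : ℝ) : EReal) ≤ ENNReal.log (m.evidence (Fin.last K)) ∧
    -- it dominates the uncollapsed bound, with equality at the optimal variational posterior
    (∀ (ν : Fin M → ℝ) (S : Matrix (Fin M) (Fin M) ℝ), S.PosDef →
      m.LSVGP ν S ≤ ((m.LREC : ℝ) : EReal)) ∧
    m.LSVGP (m.mean (Fin.last K)) (m.cov (Fin.last K)) = ((m.LREC : ℝ) : EReal) := by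
  exact ⟨⟨SparseGP.Model.log_evidence_last hkernel hR hσ,
      SparseGP.Model.sum_term_le_log_evidence hkernel hR hσ⟩,
    ⟨SparseGP.Model.isRecursiveMaximizer_qStar hkernel hR hσ, fun _ hq =>
      ⟨hq.ae_eq_qStar hkernel hR hσ, hq.bound_eq hkernel hR hσ⟩⟩,
    SparseGP.Model.cov_posDef hkernel hR hσ,
    SparseGP.Model.bayes_update hkernel hR hσ,
    fun k => ⟨SparseGP.Model.kalman_mean hkernel hR hσ k,
      SparseGP.Model.kalman_cov hkernel hR hσ k⟩,
    SparseGP.Model.LREC_eq_innovation,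
    SparseGP.Model.LREC_eq_LVFE hkernel hR hσ,
    SparseGP.Model.LREC_le_log_evidence hkernel hR hσ,
    fun ν _ hS => SparseGP.Model.LSVGP_le hkernel hR hσ ν hS,
    SparseGP.Model.LSVGP_optimum hkernel hR hσ⟩
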